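/- **Setting.** Let $k$ be a field and $X$ a well-ordered set. Let $X^{**}$ be the set of (nonempty) non-associative words in $X$ with the deg-lex order: words are compared first by length, letters by the order of $X$, and products $(u_1)(u_2)$, $(v_1)(v_2)$ of equal length lexicographically ($(u_1)$ with $(v_1)$, then $(u_2)$ with $(v_2)$). Good words are defined inductively: each letter is good; $((v)(w))$ is good if $(v),(w)$ are good and, in case $(v)=((v_1)(v_2))$, also $(v_2)\le (w)$. Let $RS\langle X\rangle$ be the free (non-unital) right-symmetric $k$-algebra on $X$, i.e. the free non-associative algebra modulo the identity $(x,y,z)=(x,z,y)$ for the associator $(x,y,z)=(xy)z-x(yz)$. The good words form a linear basis of it; the leading word $\bar f$ of $f\ne 0$ is the largest good word occurring in $f$, and $f$ is monic if its coefficient is $1$. For a set $S$ of monic elements, an $S$-word is obtained from some $s\in S$ by successively multiplying on the left or on the right by good words; it is written $(asb)$, and $(a\bar s b)$ is the word obtained by putting $\bar s$ in the place of $s$. The $S$-word is normal, written $[asb]$, if $(a\bar s b)$ is a good word. For $f,g\in S$ there are two kinds of compositions. - Inclusion: if $\bar f=[a\bar g b]$ with $[agb]$ normal, the composition is $f-[agb]$.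 It is trivial mod $S$ if it is a linear combination of normal $S$-words $[a_is_ib_i]$ with $[a_i\bar s_ib_i]<\bar f$. - Right multiplication: if $[w]$ is a good word and $(\bar f[w])$ is not good, the composition is $f\cdot[w]$. It is trivial mod $S$ if it is a linear combination of normal $S$-words $[a_is_ib_i]$ with $[a_i\bar s_ib_i]\le\overline{f\cdot[w]}$. A (possibly empty) set $S$ of monic elements is a Gröbner–Shirshov basis in $RS\langle X\rangle$ if all compositions of its elements are trivial mod $S$. **Theorem.** Let $\mathscr L$ be a Lie algebra over $k$ with a well-ordered basis $\{e_i\mid i\in I\}$, write $[e_i,e_j]=\sum_m\alpha_{ij}^m e_m$, and let $\{e_ie_j\}=\sum_m\alpha_{ij}^m e_m$, regarded as an element of $RS\langle X\rangle$ with $X=\{e_i\}_{i\in I}$. Put $f_{ij}=e_ie_j-e_je_i-\{e_ie_j\}$ and let $$U(\mathscr L)=RS\langle X\mid e_ie_j-e_je_i=\{e_ie_j\},\ i,j\in I\rangle$$ be the universal enveloping right-symmetric algebra of $\mathscr L$, i.e. the quotient of $RS\langle X\rangle$ by the ideal generated by all $f_{ij}$, $i,j\in I$. Let $S=\{f_{ij}\mid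 i,j\in I,\ i>j\}$. Then: 1. $S$ is a Gröbner–Shirshov basis in $RS\langle X\rangle$. More precisely, each $f_{ij}$ with $i>j$ is monic with leading word $e_ie_j$; the right-multiplication compositions of elements of $S$ are exactly the products $f_{ij}\cdot e_l$ with $i>j>l$, and they are trivial mod $S$; and the only inclusion compositions in $S$ are those of an $f\in S$ with itself, which are equal to $0$. 2. $\mathscr L$ embeds as a vector space into $U(\mathscr L)$: the canonical linear map $\mathscr L\to U(\mathscr L)$ that sends each $e_i$ to the class of $e_i$ is injective. -/

import Mathlib

namespace RightSymmetric

noncomputable section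

/-! ## Two-sided ideals and quotients of non-associative algebras -/

section Quotients

variable (k : Type*) [CommRing k] {A : Type*} [NonUnitalNonAssocRing A] [Module k A]

/-- The (two-sided, `k`-linear) ideal of a non-associative algebra generated by a set. -/
def idealSpan (S : Set A) : Submodule k A :=
  sInf {J : Submodule k A | S ⊆ J ∧ ∀ x ∈ J, ∀ a : A, a * x ∈ J ∧ x * a ∈ J}

theorem subset_idealSpan {S : Set A} {x : A} (hx : x ∈ S) : x ∈ idealSpan k S :=
  Submodule.mem_sInf.2 fun _ hJ => hJ.1 hx

theorem mul_mem_idealSpan {S : Set A} {x : A} (hx : x ∈ idealSpan k S) (a : A) :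
    a * x ∈ idealSpan k S ∧ x * a ∈ idealSpan k S :=
  ⟨Submodule.mem_sInf.2 fun J hJ => (hJ.2 x (Submodule.mem_sInf.1 hx J hJ) a).1,
    Submodule.mem_sInf.2 fun J hJ => (hJ.2 x (Submodule.mem_sInf.1 hx J hJ) a).2⟩

/-- The quotient of a non-associative algebra by the ideal generated by a set. -/
def QuotientAlgebra (S : Set A) : Type _ := A ⧸ idealSpan k S

namespace QuotientAlgebra

variable (S : Set A)

instance instAddCommGroup : AddCommGroup (QuotientAlgebra k S) :=
  inferInstanceAs (AddCommGroup (A ⧸ idealSpan k S))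

instance instModule : Module k (QuotientAlgebra k S) :=
  inferInstanceAs (Module k (A ⧸ idealSpan k S))

/-- The quotient map. -/
def mk : A →ₗ[k] QuotientAlgebra k S := (idealSpan k S).mkQ

theorem mk_surjective : Function.Surjective (mk k S) := (idealSpan k S).mkQ_surjective

theorem mk_eq_iff {x y : A} : mk k S x = mk k S y ↔ x - y ∈ idealSpan k S :=
  Submodule.Quotient.eq _

instance instMul : Mul (QuotientAlgebra k S) where
  mul := Quotient.map₂ (· * ·) (by
    intro a a' ha b b' hb
    rw [← Quotient.eq_iff_equiv] at ha hb ⊢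
    replace ha := (mk_eq_iff k S).1 ha
    replace hb := (mk_eq_iff k S).1 hb
    refine (mk_eq_iff k S).2 ?_
    have h : a * b - a' * b' = (a - a') * b + a' * (b - b') := by
      rw [sub_mul, mul_sub]; abel
    rw [h]
    exact add_mem (mul_mem_idealSpan k ha b).2 (mul_mem_idealSpan k hb a').1)

theorem mk_mul (x y : A) : mk k S (x * y) = mk k S x * mk k S y := rfl

instance instNonUnitalNonAssocRing : NonUnitalNonAssocRing (QuotientAlgebra k S) :=
  { instAddCommGroup k S, instMul k S with
    left_distrib := by
      intro a b c
      obtain ⟨a, rfl⟩ := mk_surjective k S a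
      obtain ⟨b, rfl⟩ := mk_surjective k S b
      obtain ⟨c, rfl⟩ := mk_surjective k S c
      change mk k S a * (mk k S b + mk k S c) = mk k S a * mk k S b + mk k S a * mk k S c
      rw [← map_add, ← mk_mul, ← mk_mul, ← mk_mul, mul_add, map_add]
    right_distrib := by
      intro a b c
      obtain ⟨a, rfl⟩ := mk_surjective k S a
      obtain ⟨b, rfl⟩ := mk_surjective k S b
      obtain ⟨c, rfl⟩ := mk_surjective k S c
      change (mk k S a + mk k S b) * mk k S c = mk k S a * mk k S c + mk k S b * mk k S c
      rw [← map_add, ← mk_mul, ← mk_mul, ← mk_mul, add_mul, map_add]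
    zero_mul := by
      intro a
      obtain ⟨a, rfl⟩ := mk_surjective k S a
      change (0 : QuotientAlgebra k S) * mk k S a = 0
      rw [← map_zero (mk k S), ← mk_mul, zero_mul]
    mul_zero := by
      intro a
      obtain ⟨a, rfl⟩ := mk_surjective k S a
      change mk k S a * (0 : QuotientAlgebra k S) = 0
      rw [← map_zero (mk k S), ← mk_mul, mul_zero] }

instance instIsScalarTower [IsScalarTower k A A] :
    IsScalarTower k (QuotientAlgebra k S) (QuotientAlgebra k S) where
  smul_assoc := by
    intro r a b
    obtain ⟨a, rfl⟩ := mk_surjective k S a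
    obtain ⟨b, rfl⟩ := mk_surjective k S b
    simp only [smul_eq_mul]
    rw [← map_smul, ← mk_mul, ← mk_mul, ← map_smul, smul_mul_assoc]

instance instSMulCommClass [SMulCommClass k A A] :
    SMulCommClass k (QuotientAlgebra k S) (QuotientAlgebra k S) where
  smul_comm := by
    intro r a b
    obtain ⟨a, rfl⟩ := mk_surjective k S a
    obtain ⟨b, rfl⟩ := mk_surjective k S b
    simp only [smul_eq_mul]
    rw [← map_smul, ← mk_mul, ← mk_mul, ← map_smul, mul_smul_comm]

end QuotientAlgebra

end Quotients

/-! ## The free right-symmetric algebra -/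

section Free

variable (k : Type*) [Field k] (X : Type*)

/-- The elements `(x, y, z) - (x, z, y)` of the free non-associative algebra. -/
def rightSymmetricRelations : Set (FreeNonUnitalNonAssocAlgebra k X) :=
  {r | ∃ x y z : FreeNonUnitalNonAssocAlgebra k X, r = associator x y z - associator x z y}

/-- The free right-symmetric algebra on `X`: the free non-associative (non-unital) algebra modulo
the ideal generated by the right-symmetric identity `(x, y, z) = (x, z, y)`. -/
def FreeRS : Type _ := QuotientAlgebra k (rightSymmetricRelations k X)

namespace FreeRS

instance instRightPreLieRing : RightPreLieRing (FreeRS k X) :=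
  { QuotientAlgebra.instNonUnitalNonAssocRing k (rightSymmetricRelations k X) with
    assoc_symm' := by
      intro x y z
      obtain ⟨x, rfl⟩ := QuotientAlgebra.mk_surjective k (rightSymmetricRelations k X) x
      obtain ⟨y, rfl⟩ := QuotientAlgebra.mk_surjective k (rightSymmetricRelations k X) y
      obtain ⟨z, rfl⟩ := QuotientAlgebra.mk_surjective k (rightSymmetricRelations k X) z
      exact (QuotientAlgebra.mk_eq_iff k (rightSymmetricRelations k X)
        (x := associator x y z) (y := associator x z y)).2
        (subset_idealSpan k ⟨x, y, z, rfl⟩) }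

instance instModule : Module k (FreeRS k X) :=
  inferInstanceAs (Module k (QuotientAlgebra k (rightSymmetricRelations k X)))

instance instRightPreLieAlgebra : RightPreLieAlgebra k (FreeRS k X) :=
  { instModule k X with
    smul_assoc := (QuotientAlgebra.instIsScalarTower k (rightSymmetricRelations k X)).smul_assoc
    smul_comm := (QuotientAlgebra.instSMulCommClass k (rightSymmetricRelations k X)).smul_comm }

variable {X}

/-- The free generators. -/
def gen (x : X) : FreeRS k X :=
  QuotientAlgebra.mk k (rightSymmetricRelations k X) (FreeNonUnitalNonAssocAlgebra.of k x)

/-- The value in the free right-symmetric algebra of a non-associative word. -/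
def ofWord : FreeMagma X → FreeRS k X := FreeMagma.lift (gen k)

end FreeRS

end Free

/-! ## Non-associative words: the deg-lex order and good words -/

section Words

variable {X : Type*} [LinearOrder X]

/-- The strict deg-lex order on non-associative words: words are compared by length first,
letters by the given order of the alphabet, and products `u₁ u₂`, `v₁ v₂` of equal length
lexicographically, `u₁` with `v₁` and then `u₂` with `v₂`. -/
inductive WordLT : FreeMagma X → FreeMagma X → Prop
  | length {u v : FreeMagma X} : u.length < v.length → WordLT u v
  | letter {x y : X} : x < y → WordLT (FreeMagma.of x) (FreeMagma.of y)
  | left {u₁ u₂ v₁ v₂ : FreeMagma X} : (u₁ * u₂).length = (v₁ * v₂).length →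
      WordLT u₁ v₁ → WordLT (u₁ * u₂) (v₁ * v₂)
  | right {u u₂ v₂ : FreeMagma X} : u₂.length = v₂.length →
      WordLT u₂ v₂ → WordLT (u * u₂) (u * v₂)

/-- The non-strict deg-lex order on non-associative words. -/
def WordLE (u v : FreeMagma X) : Prop := u = v ∨ WordLT u v

/-- Good words: every letter is good, and `v w` is good if `v`, `w` are good and, in the case
`v = v₁ v₂`, moreover `v₂ ≤ w`. -/
inductive IsGood : FreeMagma X → Prop
  | of (x : X) : IsGood (FreeMagma.of x)
  | mul {v w : FreeMagma X} : IsGood v → IsGood w →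
      (∀ v₁ v₂ : FreeMagma X, v = v₁ * v₂ → WordLE v₂ w) → IsGood (v * w)

end Words

/-! ## Compositions and Gröbner–Shirshov bases in the free right-symmetric algebra -/

section GroebnerShirshov

variable {k : Type*} [Field k] {X : Type*} [LinearOrder X]

/-- `f` is a linear combination of good words in which `w` occurs with coefficient `c ≠ 0` and is
the largest word that occurs. -/
def HasLeadingTerm (f : FreeRS k X) (w : FreeMagma X) (c : k) : Prop :=
  ∃ a : FreeMagma X →₀ k,
    (∀ v ∈ a.support, IsGood v ∧ WordLE v w) ∧ a w = c ∧ c ≠ 0 ∧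
      f = a.sum fun v r => r • FreeRS.ofWord k v

/-- `w` is the leading word of `f`. -/
def HasLeadingWord (f : FreeRS k X) (w : FreeMagma X) : Prop := ∃ c : k, HasLeadingTerm f w c

/-- `f` is monic: its leading coefficient is `1`. -/
def IsMonic (f : FreeRS k X) : Prop := ∃ w, HasLeadingTerm f w 1

/-- `IsSWord s t p u` : there is an `S`-word `(u)_s` in the letter `s` such that `p` is its value
in the free right-symmetric algebra and `u` is the non-associative word that is obtained from it
when the word `t` is put in the place of `s`. -/
inductive IsSWord (s : FreeRS k X) (t : FreeMagma X) : FreeRS k X → FreeMagma X → Prop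
  | self : IsSWord s t s t
  | mul_right {p : FreeRS k X} {u v : FreeMagma X} :
      IsSWord s t p u → IsGood v → IsSWord s t (p * FreeRS.ofWord k v) (u * v)
  | mul_left {p : FreeRS k X} {u v : FreeMagma X} :
      IsSWord s t p u → IsGood v → IsSWord s t (FreeRS.ofWord k v * p) (v * u)

/-- `p` is (the value of) a normal `S`-word `[a s b]` with `s ∈ S`, and `u` is the word
`[a s̄ b]`, where `s̄` is the leading word of `s`; normality means that `u` is good. -/
def IsNormalSWord (S : Set (FreeRS k X)) (p : FreeRS k X) (u : FreeMagma X) : Prop :=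
  ∃ s ∈ S, ∃ t, HasLeadingWord s t ∧ IsSWord s t p u ∧ IsGood u

/-- `h` is the composition of inclusion `f - [a g b]`, where `f̄ = [a ḡ b] = w`. -/
def IsInclusionComposition (f g : FreeRS k X) (w : FreeMagma X) (h : FreeRS k X) : Prop :=
  HasLeadingWord f w ∧ ∃ p, IsNormalSWord {g} p w ∧ h = f - p

/-- `f * w` is a composition of right multiplication: `w` is good and `f̄ w` is not good. -/
def IsRightMulComposition (f : FreeRS k X) (w : FreeMagma X) : Prop :=
  IsGood w ∧ ∃ t, HasLeadingWord f t ∧ ¬ IsGood (t * w)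

/-- `h` is a linear combination of normal `S`-words `[a s b]` with `[a s̄ b] < w`. -/
def IsTrivialMod (S : Set (FreeRS k X)) (w : FreeMagma X) (h : FreeRS k X) : Prop :=
  h ∈ Submodule.span k {p | ∃ u, IsNormalSWord S p u ∧ WordLT u w}

/-- `h` is a linear combination of normal `S`-words `[a s b]` with `[a s̄ b] ≤ h̄`, where `h̄` is the
leading word of `h`. -/
def IsRightMulTrivialMod (S : Set (FreeRS k X)) (h : FreeRS k X) : Prop :=
  ∃ w, HasLeadingWord h w ∧
    h ∈ Submodule.span k {p | ∃ u, IsNormalSWord S p u ∧ WordLE u w}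

/-- `S` is a Gröbner–Shirshov basis: it consists of monic elements, and all compositions of its
elements are trivial modulo `S`. -/
structure IsGroebnerShirshovBasis (S : Set (FreeRS k X)) : Prop where
  monic : ∀ f ∈ S, IsMonic f
  inclusion_trivial : ∀ f ∈ S, ∀ g ∈ S, ∀ w h,
    IsInclusionComposition f g w h → IsTrivialMod S w h
  rightMul_trivial : ∀ f ∈ S, ∀ w,
    IsRightMulComposition f w → IsRightMulTrivialMod S (f * FreeRS.ofWord k w)

end GroebnerShirshov

/-! ## The universal enveloping right-symmetric algebra of a Lie algebra -/

section Enveloping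

variable {k : Type*} [Field k] {L : Type*} [LieRing L] [LieAlgebra k L]
  {I : Type*} (b : Module.Basis I k L)

/-- The linear map from the Lie algebra to the free right-symmetric algebra on (the index set of) a
basis that sends each basis vector to the corresponding generator. -/
def linearPart : L →ₗ[k] FreeRS k I := b.constr k (FreeRS.gen k)

/-- The element `f_{ij} = e_i e_j - e_j e_i - {e_i e_j}`, where `{e_i e_j}` is the linear
combination of generators that represents the bracket of `e_i` and `e_j`. -/
def envelopingRelation (i j : I) : FreeRS k I :=
  FreeRS.gen k i * FreeRS.gen k j - FreeRS.gen k j * FreeRS.gen k i - linearPart b ⁅b i, b j⁆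

/-- The universal enveloping right-symmetric algebra, presented by the generators `e_i` and the
relations `e_i e_j - e_j e_i = {e_i e_j}` for all `i`, `j`. -/
abbrev EnvelopingRS : Type _ :=
  QuotientAlgebra k {r : FreeRS k I | ∃ i j, r = envelopingRelation b i j}

/-- The canonical linear map from the Lie algebra to its universal enveloping right-symmetric
algebra; it sends each basis vector to the class of the corresponding generator. -/
def toEnvelopingRS : L →ₗ[k] EnvelopingRS b :=
  (QuotientAlgebra.mk k {r : FreeRS k I | ∃ i j, r = envelopingRelation b i j}) ∘ₗ linearPart b

/-- The set of all `f_{ij}` with `i > j`. -/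
def envelopingBasis [LinearOrder I] : Set (FreeRS k I) :=
  {f | ∃ i j, j < i ∧ f = envelopingRelation b i j}

end Enveloping

end

end RightSymmetric

/-!
Both claims reduce to linear independence statements in quotients of the free non-associative
algebra, in which the words form a basis. Modulo the right-symmetric identity, the word `(u v) w`
with `w < v` can be replaced by `(u w) v + u (v w) - u (w v)`, and modulo `f_{ij}` with `i > j` the
word `e_i e_j` can be replaced by `e_j e_i + {e_i e_j}`; in both cases all new words are smaller.
A *relator* is such a relation, multiplied by words on either side; the relators span the ideal
that they generate. As in Bergman's diamond lemma, the irreducible words are linearly independent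
modulo the relators (`eq_zero_of_mem_relatorSpan`) as soon as two relators with the same leading
word differ by a combination of relators with smaller leading words (`Relator.sub_mem`). The deg-lex
order is a well-order, so that this rewriting ends.

Two overlaps are essential. The words `((a b) c) d` with `d < c < b` can be rewritten by the
right-symmetric identity in two ways, and the results agree because commutators satisfy the Jacobi
identity up to associator relations (`assocRel_overlap`). The words `(e_i e_j) e_l` with `i > j > l`
can be rewritten by the right-symmetric identity or by `f_{ij}`, and the results agree by the Jacobi
identity of the Lie algebra (`bracketRel_mul`).

Without the relations `f_{ij}`, the good words are irreducible; hence they are linearly independent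
in the free right-symmetric algebra, and leading words are unique (`HasLeadingWord.unique`). This
determines the compositions of the `f_{ij}`. The identity `bracketRel_mul`, read in the free
right-symmetric algebra, expresses `f_{ij} e_l` by normal words and so shows that its composition
is trivial. With the relations `f_{ij}`, the letters are still irreducible, so that the Lie algebra
embeds into its enveloping algebra (`toEnvelopingRS_injective`).
-/

namespace RightSymmetric

noncomputable section

/-! ### The deg-lex order on words -/

section Order

variable {X : Type*}

theorem length_mul (u v : FreeMagma X) : (u * v).length = u.length + v.length := rfl

theorem length_of (x : X) : (FreeMagma.of x).length = 1 := rfl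

theorem word_mul_inj {a b c d : FreeMagma X} : a * b = c * d ↔ a = c ∧ b = d := by
  refine ⟨fun h => ?_, fun h => by rw [h.1, h.2]⟩
  injection h with h₁ h₂
  exact ⟨h₁, h₂⟩

theorem of_ne_mul (x : X) (a b : FreeMagma X) : FreeMagma.of x ≠ a * b := by
  intro h
  injection h

theorem of_inj {x y : X} : FreeMagma.of x = FreeMagma.of y ↔ x = y := by
  refine ⟨fun h => ?_, fun h => by rw [h]⟩
  injection h

theorem exists_of_length_eq_one {u : FreeMagma X} (h : u.length = 1) :
    ∃ x, u = FreeMagma.of x := by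
  cases u with
  | of x => exact ⟨x, rfl⟩
  | mul a b =>
    have ha := a.length_pos
    have hb := b.length_pos
    simp only [FreeMagma.mul_eq, length_mul] at h
    omega

variable [LinearOrder X]

theorem WordLT.length_le {u v : FreeMagma X} (h : WordLT u v) : u.length ≤ v.length := by
  cases h with
  | length h => exact h.le
  | letter h => exact le_rfl
  | left h _ => exact h.le
  | right h _ => exact (congrArg (_ + ·) h).le

theorem wordLT_of_of_iff {x y : X} : WordLT (FreeMagma.of x) (FreeMagma.of y) ↔ x < y := by
  refine ⟨fun h => ?_, WordLT.letter⟩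
  generalize hu : FreeMagma.of x = u at h
  generalize hv : FreeMagma.of y = v at h
  cases h with
  | length h => subst hu hv; exact absurd h (lt_irrefl 1)
  | letter h => rw [of_inj.1 hu, of_inj.1 hv]; exact h
  | left => exact absurd hu (of_ne_mul _ _ _)
  | right => exact absurd hu (of_ne_mul _ _ _)

theorem wordLT_mul_mul_iff {a b c d : FreeMagma X} :
    WordLT (a * b) (c * d) ↔ (a * b).length < (c * d).length ∨
      (a * b).length = (c * d).length ∧ (WordLT a c ∨ a = c ∧ WordLT b d) := by
  constructor
  · intro h
    generalize hu : a * b = u at h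
    generalize hv : c * d = v at h
    cases h with
    | length h => exact Or.inl h
    | letter h => exact absurd hu.symm (of_ne_mul _ _ _)
    | left h₁ h₂ =>
      obtain ⟨rfl, rfl⟩ := word_mul_inj.1 hu
      obtain ⟨rfl, rfl⟩ := word_mul_inj.1 hv
      exact Or.inr ⟨h₁, Or.inl h₂⟩
    | right h₁ h₂ =>
      obtain ⟨rfl, rfl⟩ := word_mul_inj.1 hu
      obtain ⟨rfl, rfl⟩ := word_mul_inj.1 hv
      exact Or.inr ⟨congrArg (_ + ·) h₁, Or.inr ⟨rfl, h₂⟩⟩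
  · rintro (h | ⟨h₁, h₂ | ⟨rfl, h₂⟩⟩)
    · exact .length h
    · exact .left h₁ h₂
    · exact .right (Nat.add_left_cancel h₁) h₂

theorem not_wordLT_of_length_lt {u v : FreeMagma X} (h : v.length < u.length) : ¬ WordLT u v :=
  fun h' => absurd h'.length_le (not_le.2 h)

theorem WordLT.trans {u v w : FreeMagma X} (h₁ : WordLT u v) (h₂ : WordLT v w) : WordLT u w := by
  induction h₁ generalizing w with
  | length h => exact .length (h.trans_le h₂.length_le)
  | @letter x y h =>
    cases w with
    | of z => exact .letter (h.trans (wordLT_of_of_iff.1 h₂))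
    | mul c d =>
      have hc := c.length_pos
      have hd := d.length_pos
      refine .length ?_
      simp only [FreeMagma.mul_eq, length_mul, length_of]
      omega
  | @left u₁ u₂ v₁ v₂ h h' ih =>
    cases w with
    | of z =>
      have hc := v₁.length_pos
      have hd := v₂.length_pos
      exact absurd h₂ (not_wordLT_of_length_lt (by simp only [length_mul, length_of]; omega))
    | mul c d =>
      simp only [FreeMagma.mul_eq] at h₂ ⊢
      rcases wordLT_mul_mul_iff.1 h₂ with h₃ | ⟨h₃, h₄ | ⟨rfl, h₄⟩⟩
      · exact .length (h.trans_lt h₃)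
      · exact .left (h.trans h₃) (ih h₄)
      · exact .left (h.trans h₃) h'
  | @right u u₂ v₂ h h' ih =>
    cases w with
    | of z =>
      have hc := u.length_pos
      have hd := v₂.length_pos
      exact absurd h₂ (not_wordLT_of_length_lt (by simp only [length_mul, length_of]; omega))
    | mul c d =>
      simp only [FreeMagma.mul_eq] at h₂ ⊢
      rcases wordLT_mul_mul_iff.1 h₂ with h₃ | ⟨h₃, h₄ | ⟨rfl, h₄⟩⟩
      · exact .length (by rw [length_mul] at *; omega)
      · exact .left (by rw [length_mul] at *; omega) h₄
      · exact .right (by rw [length_mul, length_mul] at h₃; omega) (ih h₄)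

theorem wordLT_irrefl (u : FreeMagma X) : ¬ WordLT u u := by
  induction u with
  | ih1 x => exact fun h => lt_irrefl x (wordLT_of_of_iff.1 h)
  | ih2 a b iha ihb =>
    intro h
    rcases wordLT_mul_mul_iff.1 h with h₃ | ⟨h₃, h₄ | ⟨_, h₄⟩⟩
    · exact lt_irrefl _ h₃
    · exact iha h₄
    · exact ihb h₄

theorem wordLT_trichotomy (u v : FreeMagma X) : WordLT u v ∨ u = v ∨ WordLT v u := by
  induction u generalizing v with
  | ih1 x =>
    cases v with
    | of y =>
      rcases lt_trichotomy x y with h | rfl | h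
      · exact Or.inl (.letter h)
      · exact Or.inr (Or.inl rfl)
      · exact Or.inr (Or.inr (.letter h))
    | mul c d =>
      have hc := c.length_pos
      have hd := d.length_pos
      refine Or.inl (.length ?_)
      simp only [FreeMagma.mul_eq, length_mul, length_of]
      omega
  | ih2 a b iha ihb =>
    cases v with
    | of y =>
      have ha := a.length_pos
      have hb := b.length_pos
      refine Or.inr (Or.inr (.length ?_))
      simp only [length_mul, length_of]
      omega
    | mul c d =>
      simp only [FreeMagma.mul_eq]
      rcases lt_trichotomy (a * b).length (c * d).length with h | h | h
      · exact Or.inl (.length h)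
      · rcases iha c with h' | rfl | h'
        · exact Or.inl (.left h h')
        · have hbd : b.length = d.length := Nat.add_left_cancel h
          rcases ihb d with h' | rfl | h'
          · exact Or.inl (.right hbd h')
          · exact Or.inr (Or.inl rfl)
          · exact Or.inr (Or.inr (.right hbd.symm h'))
        · exact Or.inr (Or.inr (.left h.symm h'))
      · exact Or.inr (Or.inr (.length h))

theorem WordLE.trans_lt {u v w : FreeMagma X} (h₁ : WordLE u v) (h₂ : WordLT v w) :
    WordLT u w := by
  rcases h₁ with rfl | h₁
  · exact h₂
  · exact h₁.trans h₂

theorem WordLE.antisymm {u v : FreeMagma X} (h₁ : WordLE u v) (h₂ : WordLE v u) : u = v := by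
  rcases h₁ with rfl | h₁
  · rfl
  · exact absurd (h₂.trans_lt h₁) (wordLT_irrefl _)

theorem not_wordLE_iff {u v : FreeMagma X} : ¬ WordLE u v ↔ WordLT v u := by
  refine ⟨fun h => ?_, fun h h' => wordLT_irrefl _ (h'.trans_lt h)⟩
  rcases wordLT_trichotomy u v with h' | h' | h'
  · exact absurd (Or.inr h') h
  · exact absurd (Or.inl h') h
  · exact h'

theorem WordLT.mul_right {u v : FreeMagma X} (h : WordLT u v) (w : FreeMagma X) :
    WordLT (u * w) (v * w) := by
  rcases h.length_le.lt_or_eq with h' | h'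
  · exact .length (Nat.add_lt_add_right h' _)
  · exact .left (congrArg (· + _) h') h

theorem WordLT.mul_left {u v : FreeMagma X} (h : WordLT u v) (w : FreeMagma X) :
    WordLT (w * u) (w * v) := by
  rcases h.length_le.lt_or_eq with h' | h'
  · exact .length (Nat.add_lt_add_left h' _)
  · exact .right h' h

theorem WordLT.mul {a b c d : FreeMagma X} (h₁ : WordLT a c) (h₂ : WordLE b d) :
    WordLT (a * b) (c * d) := by
  rcases h₂ with rfl | h₂
  · exact h₁.mul_right _
  · exact (h₁.mul_right _).trans (h₂.mul_left _)

/-- By induction on the length: among the words of a given length, the order is the lexicographic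
order of the pairs of factors, which are shorter words. -/
theorem wordLT_wellFounded [WellFoundedLT X] :
    WellFounded (WordLT : FreeMagma X → FreeMagma X → Prop) := by
  have key : ∀ n : ℕ, ∀ w : FreeMagma X, w.length = n → Acc WordLT w := by
    intro n
    induction n using Nat.strong_induction_on with
    | _ n ih =>
      have short : ∀ w : FreeMagma X, w.length < n → Acc WordLT w := fun w hw => ih _ hw w rfl
      intro w hw
      cases w with
      | of x =>
        clear hw
        induction x using WellFoundedLT.induction with
        | _ x ihx =>
          refine ⟨_, fun v hv => ?_⟩
          obtain ⟨y, rfl⟩ := exists_of_length_eq_one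
            (le_antisymm hv.length_le v.length_pos)
          exact ihx y (wordLT_of_of_iff.1 hv)
      | mul a b =>
        simp only [FreeMagma.mul_eq] at hw ⊢
        have ha := short a (by have := b.length_pos; rw [length_mul] at hw; omega)
        induction ha generalizing b with
        | intro a _ iha =>
          have hb := short b (by have := a.length_pos; rw [length_mul] at hw; omega)
          induction hb with
          | intro b _ ihb =>
            refine ⟨_, fun v hv => ?_⟩
            rcases hv.length_le.lt_or_eq with hlt | heq
            · exact short v (hlt.trans_eq hw)
            · cases v with
              | of x =>
                have := a.length_pos
                have := b.length_pos
                simp only [length_mul, length_of] at heq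
                omega
              | mul c d =>
                simp only [FreeMagma.mul_eq] at hv heq ⊢
                rcases wordLT_mul_mul_iff.1 hv with h | ⟨_, h | ⟨rfl, h⟩⟩
                · exact absurd heq h.ne
                · exact iha c h d (heq.trans hw)
                · exact ihb d h (heq.trans hw)
  exact ⟨fun w => key _ w rfl⟩

end Order

/-! ### Spans of words and of relators in the free non-associative algebra -/

section Relators

/-- The difference `(x, y, z) - (x, z, y)` of associators, which vanishes in a right-symmetric
algebra. -/
def assocRel {A : Type*} [NonUnitalNonAssocRing A] (x y z : A) : A :=
  associator x y z - associator x z y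

theorem assocRel_eq {A : Type*} [NonUnitalNonAssocRing A] (x y z : A) :
    assocRel x y z = x * y * z - x * (y * z) - (x * z * y - x * (z * y)) := rfl

theorem assocRel_self {A : Type*} [NonUnitalNonAssocRing A] (x y : A) : assocRel x y y = 0 :=
  sub_self _

theorem neg_assocRel {A : Type*} [NonUnitalNonAssocRing A] (x y z : A) :
    -assocRel x y z = assocRel x z y :=
  neg_sub _ _

variable (k : Type*) [Field k] {X : Type*}

/-- A non-associative word as an element of the free non-associative algebra. -/
def word (w : FreeMagma X) : FreeNonUnitalNonAssocAlgebra k X := MonoidAlgebra.single w 1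

theorem word_mul (u v : FreeMagma X) : word k (u * v) = word k u * word k v := by
  simp [word]

/-- The span of a set of words in the free non-associative algebra. -/
def wordSpan (s : Set (FreeMagma X)) : Submodule k (FreeNonUnitalNonAssocAlgebra k X) :=
  Submodule.span k (word k '' s)

variable {k}

theorem word_mem_wordSpan {s : Set (FreeMagma X)} {w : FreeMagma X} (h : w ∈ s) :
    word k w ∈ wordSpan k s :=
  Submodule.subset_span ⟨w, h, rfl⟩

theorem map_wordSpan_le {M : Type*} [AddCommGroup M] [Module k M]
    (φ : FreeNonUnitalNonAssocAlgebra k X →ₗ[k] M) {s : Set (FreeMagma X)} {N : Submodule k M}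
    (h : ∀ v ∈ s, φ (word k v) ∈ N) {z : FreeNonUnitalNonAssocAlgebra k X}
    (hz : z ∈ wordSpan k s) : φ z ∈ N := by
  have : wordSpan k s ≤ N.comap φ := Submodule.span_le.2 (by rintro _ ⟨v, hv, rfl⟩; exact h v hv)
  exact this hz

theorem mem_wordSpan_univ (z : FreeNonUnitalNonAssocAlgebra k X) :
    z ∈ wordSpan k (Set.univ : Set (FreeMagma X)) := by
  have h := MonoidAlgebra.supported_eq_span_single k (Set.univ : Set (FreeMagma X))
  change z ∈ Submodule.span k ((fun m => MonoidAlgebra.single m 1) '' Set.univ)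
  rw [← h]
  exact Set.subset_univ _

theorem coeff_eq_zero_of_mem_wordSpan {s : Set (FreeMagma X)} {w : FreeMagma X} (hw : w ∉ s)
    {z : FreeNonUnitalNonAssocAlgebra k X} (hz : z ∈ wordSpan k s) : z.coeff w = 0 := by
  have h := MonoidAlgebra.supported_eq_span_single k s
  change z ∈ Submodule.span k ((fun m => MonoidAlgebra.single m 1) '' s) at hz
  rw [← h] at hz
  exact MonoidAlgebra.mem_supported'.1 hz w hw

theorem wordSpan_mono {s s' : Set (FreeMagma X)} (h : s ⊆ s') : wordSpan k s ≤ wordSpan k s' :=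
  Submodule.span_mono (Set.image_mono h)

theorem mul_word_mem_wordSpan {s s' : Set (FreeMagma X)} {w : FreeMagma X}
    (h : ∀ t ∈ s, t * w ∈ s') {z : FreeNonUnitalNonAssocAlgebra k X} (hz : z ∈ wordSpan k s) :
    z * word k w ∈ wordSpan k s' :=
  map_wordSpan_le (LinearMap.mulRight k (word k w))
    (fun v hv => by
      rw [LinearMap.mulRight_apply, ← word_mul]; exact word_mem_wordSpan (h v hv)) hz

theorem word_mul_mem_wordSpan {s s' : Set (FreeMagma X)} {w : FreeMagma X}
    (h : ∀ t ∈ s, w * t ∈ s') {z : FreeNonUnitalNonAssocAlgebra k X} (hz : z ∈ wordSpan k s) :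
    word k w * z ∈ wordSpan k s' :=
  map_wordSpan_le (LinearMap.mulLeft k (word k w))
    (fun v hv => by
      rw [LinearMap.mulLeft_apply, ← word_mul]; exact word_mem_wordSpan (h v hv)) hz

variable [LinearOrder X]

/-- The words that are strictly smaller than `w`. -/
def lower (w : FreeMagma X) : Set (FreeMagma X) := {t | WordLT t w}

/-- `Relator B g t` says that `g` is obtained, by multiplying with words on either side, from
an instance of the right-symmetric identity or from an element `f` with `B f i j`; the word `t` is
the leading word of `g`. The relation `B f i j` is meant to hold for the additional relations `f`,
with leading word `e_i e_j`. -/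
inductive Relator (B : FreeNonUnitalNonAssocAlgebra k X → X → X → Prop) :
    FreeNonUnitalNonAssocAlgebra k X → FreeMagma X → Prop
  | base {f : FreeNonUnitalNonAssocAlgebra k X} {i j : X} : B f i j →
      Relator B f (FreeMagma.of i * FreeMagma.of j)
  | assoc (u : FreeMagma X) {v w : FreeMagma X} : WordLT w v →
      Relator B (assocRel (word k u) (word k v) (word k w)) (u * v * w)
  | mul_right {g : FreeNonUnitalNonAssocAlgebra k X} {t : FreeMagma X} (w : FreeMagma X) :
      Relator B g t → Relator B (g * word k w) (t * w)
  | mul_left {g : FreeNonUnitalNonAssocAlgebra k X} {t : FreeMagma X} (w : FreeMagma X) :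
      Relator B g t → Relator B (word k w * g) (w * t)

variable {B : FreeNonUnitalNonAssocAlgebra k X → X → X → Prop}

theorem relator_mul_iff {g : FreeNonUnitalNonAssocAlgebra k X} {a b : FreeMagma X} :
    Relator B g (a * b) ↔
      (∃ i j, a = FreeMagma.of i ∧ b = FreeMagma.of j ∧ B g i j) ∨
      (∃ u v, a = u * v ∧ WordLT b v ∧ g = assocRel (word k u) (word k v) (word k b)) ∨
      (∃ g', Relator B g' a ∧ g = g' * word k b) ∨
      (∃ g', Relator B g' b ∧ g = word k a * g') := by
  constructor
  · intro h
    generalize hw : a * b = w at h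
    cases h with
    | @base _ i j h =>
      obtain ⟨rfl, rfl⟩ := word_mul_inj.1 hw
      exact Or.inl ⟨i, j, rfl, rfl, h⟩
    | @assoc u v w h =>
      obtain ⟨rfl, rfl⟩ := word_mul_inj.1 hw
      exact Or.inr (Or.inl ⟨u, v, rfl, h, rfl⟩)
    | mul_right w h =>
      obtain ⟨rfl, rfl⟩ := word_mul_inj.1 hw
      exact Or.inr (Or.inr (Or.inl ⟨_, h, rfl⟩))
    | mul_left w h =>
      obtain ⟨rfl, rfl⟩ := word_mul_inj.1 hw
      exact Or.inr (Or.inr (Or.inr ⟨_, h, rfl⟩))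
  · rintro (⟨i, j, rfl, rfl, h⟩ | ⟨u, v, rfl, h, rfl⟩ | ⟨g', h, rfl⟩ | ⟨g', h, rfl⟩)
    · exact .base h
    · exact .assoc u h
    · exact .mul_right b h
    · exact .mul_left a h

theorem not_relator_of (g : FreeNonUnitalNonAssocAlgebra k X) (x : X) :
    ¬ Relator B g (FreeMagma.of x) := by
  intro h
  generalize hw : FreeMagma.of x = w at h
  cases h <;> exact of_ne_mul _ _ _ hw

/-- The span of the relators whose leading word lies in a given set. -/
def relatorSpan (B : FreeNonUnitalNonAssocAlgebra k X → X → X → Prop) (s : Set (FreeMagma X)) :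
    Submodule k (FreeNonUnitalNonAssocAlgebra k X) :=
  Submodule.span k {g | ∃ t ∈ s, Relator B g t}

theorem Relator.mem_relatorSpan {g : FreeNonUnitalNonAssocAlgebra k X} {t : FreeMagma X}
    (h : Relator B g t) {s : Set (FreeMagma X)} (ht : t ∈ s) : g ∈ relatorSpan B s :=
  Submodule.subset_span ⟨t, ht, h⟩

theorem relatorSpan_mono {s s' : Set (FreeMagma X)} (h : s ⊆ s') :
    relatorSpan B s ≤ relatorSpan B s' :=
  Submodule.span_mono fun _ ⟨t, ht, hg⟩ => ⟨t, h ht, hg⟩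

theorem map_relatorSpan_le {M : Type*} [AddCommGroup M] [Module k M]
    (φ : FreeNonUnitalNonAssocAlgebra k X →ₗ[k] M) {s : Set (FreeMagma X)} {N : Submodule k M}
    (h : ∀ g, ∀ t ∈ s, Relator B g t → φ g ∈ N) {z : FreeNonUnitalNonAssocAlgebra k X}
    (hz : z ∈ relatorSpan B s) : φ z ∈ N := by
  have : relatorSpan B s ≤ N.comap φ :=
    Submodule.span_le.2 (by rintro g ⟨t, ht, hg⟩; exact h g t ht hg)
  exact this hz

theorem mul_word_mem_relatorSpan {s s' : Set (FreeMagma X)} {w : FreeMagma X}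
    (h : ∀ t ∈ s, t * w ∈ s') {z : FreeNonUnitalNonAssocAlgebra k X}
    (hz : z ∈ relatorSpan B s) : z * word k w ∈ relatorSpan B s' :=
  map_relatorSpan_le (LinearMap.mulRight k (word k w))
    (fun _ t ht hg => (hg.mul_right w).mem_relatorSpan (h t ht)) hz

theorem word_mul_mem_relatorSpan {s s' : Set (FreeMagma X)} {w : FreeMagma X}
    (h : ∀ t ∈ s, w * t ∈ s') {z : FreeNonUnitalNonAssocAlgebra k X}
    (hz : z ∈ relatorSpan B s) : word k w * z ∈ relatorSpan B s' :=
  map_relatorSpan_le (LinearMap.mulLeft k (word k w))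
    (fun _ t ht hg => (hg.mul_left w).mem_relatorSpan (h t ht)) hz

theorem Relator.mul_mem {g : FreeNonUnitalNonAssocAlgebra k X} {t : FreeMagma X}
    (hg : Relator B g t) {s s' : Set (FreeMagma X)} (h : ∀ v ∈ s, t * v ∈ s')
    {z : FreeNonUnitalNonAssocAlgebra k X} (hz : z ∈ wordSpan k s) :
    g * z ∈ relatorSpan B s' :=
  map_wordSpan_le (LinearMap.mulLeft k g)
    (fun v hv => (hg.mul_right v).mem_relatorSpan (h v hv)) hz

theorem Relator.mem_mul {g : FreeNonUnitalNonAssocAlgebra k X} {t : FreeMagma X}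
    (hg : Relator B g t) {s s' : Set (FreeMagma X)} (h : ∀ v ∈ s, v * t ∈ s')
    {z : FreeNonUnitalNonAssocAlgebra k X} (hz : z ∈ wordSpan k s) :
    z * g ∈ relatorSpan B s' :=
  map_wordSpan_le (LinearMap.mulRight k g)
    (fun v hv => (hg.mul_left v).mem_relatorSpan (h v hv)) hz

theorem assocRel_mem_relatorSpan {s : Set (FreeMagma X)} {u v w : FreeMagma X}
    (h₁ : u * v * w ∈ s) (h₂ : u * w * v ∈ s) :
    assocRel (word k u) (word k v) (word k w) ∈ relatorSpan B s := by
  rcases wordLT_trichotomy v w with h | rfl | h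
  · rw [← neg_assocRel]
    exact neg_mem ((Relator.assoc u h).mem_relatorSpan h₂)
  · rw [assocRel_self]
    exact zero_mem _
  · exact (Relator.assoc u h).mem_relatorSpan h₁

/-- `assocRel` as a linear map in its first argument. -/
def assocRelFst (y z : FreeNonUnitalNonAssocAlgebra k X) :
    FreeNonUnitalNonAssocAlgebra k X →ₗ[k] FreeNonUnitalNonAssocAlgebra k X where
  toFun x := assocRel x y z
  map_add' x x' := by simp only [assocRel_eq, add_mul]; abel
  map_smul' c x := by simp only [assocRel_eq, smul_mul_assoc, ← smul_sub, RingHom.id_apply]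

/-- `assocRel` as a linear map in its second argument. -/
def assocRelSnd (x z : FreeNonUnitalNonAssocAlgebra k X) :
    FreeNonUnitalNonAssocAlgebra k X →ₗ[k] FreeNonUnitalNonAssocAlgebra k X where
  toFun y := assocRel x y z
  map_add' y y' := by simp only [assocRel_eq, add_mul, mul_add]; abel
  map_smul' c y := by
    simp only [assocRel_eq, smul_mul_assoc, mul_smul_comm, ← smul_sub, RingHom.id_apply]

/-- `assocRel` as a linear map in its third argument. -/
def assocRelThd (x y : FreeNonUnitalNonAssocAlgebra k X) :
    FreeNonUnitalNonAssocAlgebra k X →ₗ[k] FreeNonUnitalNonAssocAlgebra k X where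
  toFun z := assocRel x y z
  map_add' z z' := by simp only [assocRel_eq, add_mul, mul_add]; abel
  map_smul' c z := by
    simp only [assocRel_eq, smul_mul_assoc, mul_smul_comm, ← smul_sub, RingHom.id_apply]

theorem assocRel_mem_of_wordSpan {s₁ s₂ s₃ : Set (FreeMagma X)} {s : Set (FreeMagma X)}
    (h₁ : ∀ u ∈ s₁, ∀ v ∈ s₂, ∀ w ∈ s₃, u * v * w ∈ s)
    (h₂ : ∀ u ∈ s₁, ∀ v ∈ s₂, ∀ w ∈ s₃, u * w * v ∈ s)
    {x y z : FreeNonUnitalNonAssocAlgebra k X} (hx : x ∈ wordSpan k s₁) (hy : y ∈ wordSpan k s₂)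
    (hz : z ∈ wordSpan k s₃) : assocRel x y z ∈ relatorSpan B s :=
  map_wordSpan_le (assocRelFst y z) (fun u hu =>
    map_wordSpan_le (assocRelSnd (word k u) z) (fun v hv =>
      map_wordSpan_le (assocRelThd (word k u) (word k v)) (fun w hw =>
        assocRel_mem_relatorSpan (h₁ u hu v hv w hw) (h₂ u hu v hv w hw)) hz) hy) hx

theorem mul_mul_lt_of_lt (u : FreeMagma X) {v w : FreeMagma X} (h : WordLT w v) :
    WordLT (u * w * v) (u * v * w) := by
  refine .left ?_ (h.mul_left u)
  simp only [length_mul]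
  omega

theorem mul_mul_lt_mul_mul (u v w : FreeMagma X) {v' w' : FreeMagma X}
    (h : v'.length + w'.length ≤ v.length + w.length) :
    WordLT (u * (v' * w')) (u * v * w) := by
  have hl : (u * (v' * w')).length ≤ (u * v * w).length := by
    simp only [length_mul]
    omega
  rcases hl.lt_or_eq with hl | hl
  · exact .length hl
  · refine .left hl (.length ?_)
    have := v.length_pos
    simp only [length_mul]
    omega

/-- Overlaps of the additional relations with each other and with the right-symmetric identity are
resolvable. -/
structure IsResolvable (B : FreeNonUnitalNonAssocAlgebra k X → X → X → Prop) : Prop where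
  lead : ∀ {f i j}, B f i j → f - word k (FreeMagma.of i * FreeMagma.of j) ∈
    wordSpan k (lower (FreeMagma.of i * FreeMagma.of j))
  unique : ∀ {f f' i j}, B f i j → B f' i j → f = f'
  resolve : ∀ {f i j l}, B f i j → l < j →
    assocRel (word k (FreeMagma.of i)) (word k (FreeMagma.of j)) (word k (FreeMagma.of l)) -
      f * word k (FreeMagma.of l) ∈
        relatorSpan B (lower (FreeMagma.of i * FreeMagma.of j * FreeMagma.of l))

theorem Relator.sub_word_mem (hB : IsResolvable B) {g : FreeNonUnitalNonAssocAlgebra k X}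
    {t : FreeMagma X} (h : Relator B g t) : g - word k t ∈ wordSpan k (lower t) := by
  induction h with
  | base h => exact hB.lead h
  | @assoc u v w h =>
    have : assocRel (word k u) (word k v) (word k w) - word k (u * v * w) =
        word k (u * (w * v)) - word k (u * (v * w)) - word k (u * w * v) := by
      simp only [assocRel_eq, word_mul]
      abel
    rw [this]
    refine sub_mem (sub_mem (word_mem_wordSpan ?_) (word_mem_wordSpan ?_)) (word_mem_wordSpan ?_)
    · exact mul_mul_lt_mul_mul u v w (Nat.add_comm _ _).le
    · exact mul_mul_lt_mul_mul u v w le_rfl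
    · exact mul_mul_lt_of_lt u h
  | mul_right w _ ih =>
    rw [word_mul, ← sub_mul]
    exact mul_word_mem_wordSpan (fun t ht => WordLT.mul_right ht w) ih
  | mul_left w _ ih =>
    rw [word_mul, ← mul_sub]
    exact word_mul_mem_wordSpan (fun t ht => WordLT.mul_left ht w) ih

theorem Relator.mem_wordSpan (hB : IsResolvable B) {g : FreeNonUnitalNonAssocAlgebra k X}
    {t : FreeMagma X} (h : Relator B g t) {s : Set (FreeMagma X)} (ht : t ∈ s)
    (hs : lower t ⊆ s) : g ∈ wordSpan k s := by
  have := add_mem (wordSpan_mono hs (h.sub_word_mem hB)) (word_mem_wordSpan ht)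
  rwa [sub_add_cancel] at this

end Relators

/-! ### Resolution of overlaps -/

section Confluence

/-- The resolution of the overlap of the right-symmetric identities for `(a b, c, d)` and
`(a, b, c)`. It is the Jacobi identity for the commutator, up to associator relations. -/
theorem assocRel_overlap {A : Type*} [NonUnitalNonAssocRing A] (a b c d : A) :
    assocRel (a * b) c d - assocRel a b c * d =
      assocRel (a * c) b d + assocRel a c d * b - assocRel a b d * c - assocRel (a * d) b c
      + (assocRel a (c * d) b - assocRel a (d * c) b)
      + (assocRel a (b * c) d - assocRel a (c * b) d)
      - (assocRel a (b * d) c - assocRel a (d * b) c)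
      + a * (assocRel b c d + assocRel c d b + assocRel d b c) := by
  simp only [assocRel_eq, mul_sub, sub_mul, mul_add]
  abel

variable {k : Type*} [Field k] {X : Type*} [LinearOrder X]
  {B : FreeNonUnitalNonAssocAlgebra k X → X → X → Prop}

/-- The two ways to rewrite `((a b) c) d` with `d < c < b` by the right-symmetric identity agree up
to smaller relators. -/
theorem assocRel_overlap_mem (a : FreeMagma X) {b c d : FreeMagma X} (hcb : WordLT c b)
    (hdc : WordLT d c) :
    assocRel (word k (a * b)) (word k c) (word k d) -
      assocRel (word k a) (word k b) (word k c) * word k d ∈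
        relatorSpan B (lower (a * b * c * d)) := by
  have hc := hcb.length_le
  have hd := hdc.length_le
  have hc₀ := c.length_pos
  have hb₀ := b.length_pos
  have hacb : WordLT (a * c * b) (a * b * c) := mul_mul_lt_of_lt a hcb
  have hacd : WordLT (a * c * d) (a * b * c) := (hcb.mul_left a).mul (Or.inr hdc)
  have hadc : WordLT (a * d * c) (a * b * c) := ((hdc.trans hcb).mul_left a).mul_right c
  have habdc : WordLT (a * b * d * c) (a * b * c * d) := mul_mul_lt_of_lt (a * b) hdc
  have hadbc : WordLT (a * d * b * c) (a * b * c * d) :=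
    ((mul_mul_lt_of_lt a (hdc.trans hcb)).mul_right c).trans habdc
  have hadcb : WordLT (a * d * c * b) (a * b * c * d) :=
    .left (by simp only [length_mul]; omega) hadc
  have hacbd : WordLT (a * c * b * d) (a * b * c * d) := hacb.mul_right d
  have hacdb : WordLT (a * c * d * b) (a * b * c * d) :=
    .left (by simp only [length_mul]; omega) hacd
  -- Words whose left factor is `a y` with `y` short, or `a (y z)` with `y z` not too long.
  have hy : ∀ y z : FreeMagma X, y.length ≤ b.length →
      y.length + z.length = b.length + c.length + d.length →
      a * y * z ∈ lower (a * b * c * d) := fun y z h₁ h₂ =>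
    .left (by simp only [length_mul]; omega) (.length (by simp only [length_mul]; omega))
  have hyz : ∀ y z t : FreeMagma X, y.length + z.length ≤ b.length + c.length →
      y.length + z.length + t.length = b.length + c.length + d.length →
      a * (y * z) * t ∈ lower (a * b * c * d) := fun y z t h₁ h₂ =>
    .left (by simp only [length_mul]; omega) (mul_mul_lt_mul_mul a b c h₁)
  have ha : ∀ y z t : FreeMagma X,
      y.length + z.length + t.length = b.length + c.length + d.length →
      ∀ s ∈ ({y * z * t, y * t * z} : Set (FreeMagma X)), a * s ∈ lower (a * b * c * d) := by
    rintro y z t h _ (rfl | rfl) <;>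
      exact .left (by simp only [length_mul]; omega) (.length (by simp only [length_mul]; omega))
  have hself : ∀ y z t : FreeMagma X, assocRel (word k y) (word k z) (word k t) ∈
      relatorSpan B {y * z * t, y * t * z} := fun y z t =>
    assocRel_mem_relatorSpan (Or.inl rfl) (Or.inr rfl)
  rw [word_mul, assocRel_overlap, mul_add, mul_add]
  simp only [← word_mul]
  refine add_mem (sub_mem (add_mem (add_mem (sub_mem (sub_mem (add_mem ?_ ?_) ?_) ?_)
    (sub_mem ?_ ?_)) (sub_mem ?_ ?_)) (sub_mem ?_ ?_)) (add_mem (add_mem ?_ ?_) ?_)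
  · exact assocRel_mem_relatorSpan hacbd hacdb
  · exact mul_word_mem_relatorSpan (by rintro _ (rfl | rfl); exacts [hacdb, hadcb]) (hself a c d)
  · exact mul_word_mem_relatorSpan (by rintro _ (rfl | rfl); exacts [habdc, hadbc]) (hself a b d)
  · exact assocRel_mem_relatorSpan hadbc hadcb
  · exact assocRel_mem_relatorSpan (hyz _ _ _ (by omega) (by omega))
      (hy _ _ (by omega) (by simp only [length_mul]; omega))
  · exact assocRel_mem_relatorSpan (hyz _ _ _ (by omega) (by omega))
      (hy _ _ (by omega) (by simp only [length_mul]; omega))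
  · exact assocRel_mem_relatorSpan (hyz _ _ _ (by omega) (by omega))
      (hy _ _ (by omega) (by simp only [length_mul]; omega))
  · exact assocRel_mem_relatorSpan (hyz _ _ _ (by omega) (by omega))
      (hy _ _ (by omega) (by simp only [length_mul]; omega))
  · exact assocRel_mem_relatorSpan (hyz _ _ _ (by omega) (by omega))
      (hy _ _ (by omega) (by simp only [length_mul]; omega))
  · exact assocRel_mem_relatorSpan (hyz _ _ _ (by omega) (by omega))
      (hy _ _ (by omega) (by simp only [length_mul]; omega))
  · exact word_mul_mem_relatorSpan (ha b c d (by omega)) (hself b c d)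
  · exact word_mul_mem_relatorSpan (ha c d b (by omega)) (hself c d b)
  · exact word_mul_mem_relatorSpan (ha d b c (by omega)) (hself d b c)

/-- A relator applied inside the left factor `u v` of `(u v) w` agrees with the right-symmetric
identity for `(u, v, w)` up to smaller relators. -/
theorem assoc_sub_mul_right_mem (hB : IsResolvable B) {u v w : FreeMagma X} (hwv : WordLT w v)
    {g : FreeNonUnitalNonAssocAlgebra k X} (hg : Relator B g (u * v)) :
    assocRel (word k u) (word k v) (word k w) - g * word k w ∈
      relatorSpan B (lower (u * v * w)) := by
  have hswap : WordLT (u * w * v) (u * v * w) := mul_mul_lt_of_lt u hwv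
  rcases relator_mul_iff.1 hg with ⟨i, j, rfl, rfl, h⟩ | ⟨a, b, rfl, h, rfl⟩ | ⟨g', h, rfl⟩ |
    ⟨g', h, rfl⟩
  · obtain ⟨l, rfl⟩ := exists_of_length_eq_one (le_antisymm hwv.length_le w.length_pos)
    exact hB.resolve h (wordLT_of_of_iff.1 hwv)
  · exact assocRel_overlap_mem a h hwv
  · have key : assocRel (word k u) (word k v) (word k w) - g' * word k v * word k w =
        -(g' * word k (v * w)) - g' * word k w * word k v + g' * word k (w * v)
          - assocRel (g' - word k u) (word k v) (word k w) := by
      simp only [assocRel_eq, word_mul, sub_mul]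
      abel
    rw [key]
    refine sub_mem (add_mem (sub_mem (neg_mem ?_) ?_) ?_) ?_
    · exact (h.mul_right _).mem_relatorSpan (mul_mul_lt_mul_mul u v w le_rfl)
    · exact ((h.mul_right _).mul_right _).mem_relatorSpan hswap
    · exact (h.mul_right _).mem_relatorSpan (mul_mul_lt_mul_mul u v w (Nat.add_comm _ _).le)
    · refine assocRel_mem_of_wordSpan (s₁ := lower u) (s₂ := {v}) (s₃ := {w}) ?_ ?_
        (h.sub_word_mem hB) (word_mem_wordSpan rfl) (word_mem_wordSpan rfl)
      · rintro z hz _ rfl _ rfl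
        exact (WordLT.mul_right hz _).mul_right _
      · rintro z hz _ rfl _ rfl
        exact ((WordLT.mul_right hz _).mul_right _).trans hswap
  · have key : assocRel (word k u) (word k v) (word k w) - word k u * g' * word k w =
        -(word k (u * w) * g') - word k u * (g' * word k w) + word k u * (word k w * g')
          - assocRel (word k u) (g' - word k v) (word k w) := by
      simp only [assocRel_eq, word_mul, sub_mul, mul_sub]
      abel
    rw [key]
    refine sub_mem (add_mem (sub_mem (neg_mem ?_) ?_) ?_) ?_
    · exact (h.mul_left _).mem_relatorSpan hswap
    · exact ((h.mul_right _).mul_left _).mem_relatorSpan (mul_mul_lt_mul_mul u v w le_rfl)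
    · exact ((h.mul_left _).mul_left _).mem_relatorSpan
        (mul_mul_lt_mul_mul u v w (Nat.add_comm _ _).le)
    · refine assocRel_mem_of_wordSpan (s₁ := {u}) (s₂ := lower v) (s₃ := {w}) ?_ ?_
        (word_mem_wordSpan rfl) (h.sub_word_mem hB) (word_mem_wordSpan rfl)
      · rintro _ rfl z hz _ rfl
        exact (WordLT.mul_left hz _).mul_right _
      · rintro _ rfl z hz _ rfl
        exact (WordLT.mul_left hz _).trans hswap

/-- A relator applied to the right factor `w` of `(u v) w` agrees with the right-symmetric
identity for `(u, v, w)` up to smaller relators. -/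
theorem assoc_sub_mul_left_mem (hB : IsResolvable B) {u v w : FreeMagma X} (hwv : WordLT w v)
    {g : FreeNonUnitalNonAssocAlgebra k X} (hg : Relator B g w) :
    assocRel (word k u) (word k v) (word k w) - word k (u * v) * g ∈
      relatorSpan B (lower (u * v * w)) := by
  have hswap : WordLT (u * w * v) (u * v * w) := mul_mul_lt_of_lt u hwv
  have key : assocRel (word k u) (word k v) (word k w) - word k (u * v) * g =
      word k u * (g * word k v) - word k u * g * word k v - word k u * (word k v * g)
        - assocRel (word k u) (word k v) (g - word k w) := by
    simp only [assocRel_eq, word_mul, sub_mul, mul_sub]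
    abel
  rw [key]
  refine sub_mem (sub_mem (sub_mem ?_ ?_) ?_) ?_
  · exact ((hg.mul_right _).mul_left _).mem_relatorSpan
      (mul_mul_lt_mul_mul u v w (Nat.add_comm _ _).le)
  · exact ((hg.mul_left _).mul_right _).mem_relatorSpan hswap
  · exact ((hg.mul_left _).mul_left _).mem_relatorSpan (mul_mul_lt_mul_mul u v w le_rfl)
  · refine assocRel_mem_of_wordSpan (s₁ := {u}) (s₂ := {v}) (s₃ := lower w) ?_ ?_
      (word_mem_wordSpan rfl) (word_mem_wordSpan rfl) (hg.sub_word_mem hB)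
    · rintro _ rfl _ rfl z hz
      exact WordLT.mul_left hz _
    · rintro _ rfl _ rfl z hz
      exact ((WordLT.mul_left hz _).mul_right _).trans hswap

/-- Two relators with the same leading word differ by a combination of relators with smaller
leading words. -/
theorem Relator.sub_mem (hB : IsResolvable B) {t : FreeMagma X}
    {g g' : FreeNonUnitalNonAssocAlgebra k X} (hg : Relator B g t) (hg' : Relator B g' t) :
    g - g' ∈ relatorSpan B (lower t) := by
  induction t generalizing g g' with
  | ih1 x => exact absurd hg (not_relator_of g x)
  | ih2 a b iha ihb =>
    have hsymm : ∀ {x y : FreeNonUnitalNonAssocAlgebra k X},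
        x - y ∈ relatorSpan B (lower (a * b)) → y - x ∈ relatorSpan B (lower (a * b)) := by
      intro x y h
      rw [← neg_sub]
      exact neg_mem h
    -- Relators that act on different factors of `a * b` commute, up to smaller relators.
    have hdisj : ∀ {h h'}, Relator B h a → Relator B h' b →
        h * word k b - word k a * h' ∈ relatorSpan B (lower (a * b)) := by
      intro h h' hh hh'
      have key : h * word k b - word k a * h' =
          (h - word k a) * h' - h * (h' - word k b) := by
        simp only [sub_mul, mul_sub]
        abel
      rw [key]
      exact _root_.sub_mem
        (hh'.mem_mul (fun v hv => WordLT.mul_right hv b) (hh.sub_word_mem hB))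
        (hh.mul_mem (fun v hv => WordLT.mul_left hv a) (hh'.sub_word_mem hB))
    rcases relator_mul_iff.1 hg with ⟨i, j, rfl, rfl, h⟩ | ⟨u, v, rfl, h, rfl⟩ | ⟨h, hh, rfl⟩ |
      ⟨h, hh, rfl⟩
    · rcases relator_mul_iff.1 hg' with ⟨i', j', hi, hj, h'⟩ | ⟨u', v', hu, h', -⟩ |
        ⟨h', hh', -⟩ | ⟨h', hh', -⟩
      · rw [of_inj] at hi hj
        subst hi hj
        rw [hB.unique h h', sub_self]
        exact zero_mem _
      · exact absurd hu (of_ne_mul _ _ _)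
      · exact absurd hh' (not_relator_of _ _)
      · exact absurd hh' (not_relator_of _ _)
    · rcases relator_mul_iff.1 hg' with ⟨i', j', hi, hj, h'⟩ | ⟨u', v', hu, h', rfl⟩ |
        ⟨h', hh', rfl⟩ | ⟨h', hh', rfl⟩
      · exact absurd hi.symm (of_ne_mul _ _ _)
      · obtain ⟨rfl, rfl⟩ := word_mul_inj.1 hu
        rw [sub_self]
        exact zero_mem _
      · exact assoc_sub_mul_right_mem hB h hh'
      · exact assoc_sub_mul_left_mem hB h hh'
    · rcases relator_mul_iff.1 hg' with ⟨i', j', rfl, rfl, h'⟩ | ⟨u', v', rfl, h', rfl⟩ |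
        ⟨h', hh', rfl⟩ | ⟨h', hh', rfl⟩
      · exact absurd hh (not_relator_of _ _)
      · exact hsymm (assoc_sub_mul_right_mem hB h' hh)
      · rw [← sub_mul]
        exact mul_word_mem_relatorSpan (fun t ht => WordLT.mul_right ht b) (iha hh hh')
      · exact hdisj hh hh'
    · rcases relator_mul_iff.1 hg' with ⟨i', j', rfl, rfl, h'⟩ | ⟨u', v', rfl, h', rfl⟩ |
        ⟨h', hh', rfl⟩ | ⟨h', hh', rfl⟩
      · exact absurd hh (not_relator_of _ _)
      · exact hsymm (assoc_sub_mul_left_mem hB h' hh)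
      · exact hsymm (hdisj hh' hh)
      · rw [← mul_sub]
        exact word_mul_mem_relatorSpan (fun t ht => WordLT.mul_left ht a) (ihb hh hh')

/-- A combination of relators has a largest leading word among its terms. -/
theorem exists_mem_relatorSpan_le {s : Set (FreeMagma X)}
    {x : FreeNonUnitalNonAssocAlgebra k X} (hx : x ∈ relatorSpan B s) :
    x = 0 ∨ ∃ v ∈ s, x ∈ relatorSpan B {t | WordLE t v} := by
  induction hx using Submodule.span_induction with
  | mem x hx =>
    obtain ⟨t, ht, hx⟩ := hx
    exact Or.inr ⟨t, ht, hx.mem_relatorSpan (Or.inl rfl)⟩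
  | zero => exact Or.inl rfl
  | smul c x _ hx =>
    rcases hx with rfl | ⟨v, hv, hx⟩
    · exact Or.inl (smul_zero c)
    · exact Or.inr ⟨v, hv, Submodule.smul_mem _ c hx⟩
  | add x y _ _ hx hy =>
    rcases hx with rfl | ⟨v, hv, hx⟩
    · rwa [zero_add]
    · rcases hy with rfl | ⟨v', hv', hy⟩
      · rw [add_zero]
        exact Or.inr ⟨v, hv, hx⟩
      · have hle : ∀ {a b : FreeMagma X}, WordLT a b →
            relatorSpan B {t | WordLE t a} ≤ relatorSpan B {t | WordLE t b} :=
          fun hab => relatorSpan_mono fun t ht => Or.inr (WordLE.trans_lt ht hab)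
        rcases wordLT_trichotomy v v' with hvv | rfl | hvv
        · exact Or.inr ⟨v', hv', add_mem (hle hvv hx) hy⟩
        · exact Or.inr ⟨v, hv, add_mem hx hy⟩
        · exact Or.inr ⟨v, hv, add_mem hx (hle hvv hy)⟩

/-- A combination of relators up to `w` needs at most one relator with leading word `w`. -/
theorem exists_sub_smul_mem_relatorSpan (hB : IsResolvable B) {w : FreeMagma X}
    {g : FreeNonUnitalNonAssocAlgebra k X} (hg : Relator B g w)
    {x : FreeNonUnitalNonAssocAlgebra k X} (hx : x ∈ relatorSpan B {t | WordLE t w}) :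
    ∃ c : k, x - c • g ∈ relatorSpan B (lower w) := by
  induction hx using Submodule.span_induction with
  | mem x hx =>
    obtain ⟨t, rfl | ht, hx⟩ := hx
    · exact ⟨1, by rw [one_smul]; exact hx.sub_mem hB hg⟩
    · exact ⟨0, by rw [zero_smul, sub_zero]; exact hx.mem_relatorSpan ht⟩
  | zero => exact ⟨0, by rw [zero_smul, sub_zero]; exact zero_mem _⟩
  | smul c x _ hx =>
    obtain ⟨c', hx⟩ := hx
    exact ⟨c * c', by rw [mul_smul, ← smul_sub]; exact Submodule.smul_mem _ c hx⟩
  | add x y _ _ hx hy =>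
    obtain ⟨c, hx⟩ := hx
    obtain ⟨c', hy⟩ := hy
    exact ⟨c + c', by rw [add_smul, add_sub_add_comm]; exact add_mem hx hy⟩

/-- Words that are not the leading word of a relator are linearly independent modulo the relators.
In a combination of relators the largest leading word may be assumed to belong to a single relator;
it then occurs in the sum with the coefficient of that relator, which therefore vanishes. -/
theorem eq_zero_of_mem_relatorSpan [WellFoundedLT X] (hB : IsResolvable B)
    {z : FreeNonUnitalNonAssocAlgebra k X} {s : Set (FreeMagma X)} (hz : z ∈ relatorSpan B s)
    (h : ∀ g t, Relator B g t → z.coeff t = 0) : z = 0 := by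
  have step : ∀ w : FreeMagma X, z ∈ relatorSpan B {t | WordLE t w} → z = 0 := by
    intro w
    refine wordLT_wellFounded.induction (C := fun w => z ∈ relatorSpan B {t | WordLE t w} → z = 0)
      w fun w ih hw => ?_
    have hlow : z ∈ relatorSpan B (lower w) := by
      by_cases hex : ∃ g, Relator B g w
      · obtain ⟨g, hg⟩ := hex
        obtain ⟨c, hc⟩ := exists_sub_smul_mem_relatorSpan hB hg hw
        have hself : w ∉ lower w := wordLT_irrefl w
        have h₁ : (z - c • g).coeff w = 0 :=
          coeff_eq_zero_of_mem_wordSpan hself (map_relatorSpan_le LinearMap.id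
            (fun _ t ht hg => hg.mem_wordSpan hB ht fun _ hs => WordLT.trans hs ht) hc)
        have h₂ : (g - word k w).coeff w = 0 :=
          coeff_eq_zero_of_mem_wordSpan hself (hg.sub_word_mem hB)
        have h₃ : g.coeff w = 1 := by
          simpa [word, sub_eq_zero] using h₂
        have h₄ : c = 0 := by
          simpa [h _ _ hg, h₃] using h₁
        rwa [h₄, zero_smul, sub_zero] at hc
      · refine map_relatorSpan_le LinearMap.id (fun g t ht hg => ?_) hw
        rcases ht with rfl | ht
        · exact absurd ⟨g, hg⟩ hex
        · exact hg.mem_relatorSpan ht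
    rcases exists_mem_relatorSpan_le hlow with h0 | ⟨v, hv, hzv⟩
    · exact h0
    · exact ih v hv hzv
  rcases exists_mem_relatorSpan_le hz with h0 | ⟨v, _, hzv⟩
  · exact h0
  · exact step v hzv

end Confluence

/-! ### Linear independence of good words in the free right-symmetric algebra -/

section GoodWords

variable {k : Type*} [Field k] {X : Type*}

variable (k) in
/-- The quotient map from the free non-associative algebra to the free right-symmetric algebra. -/
def toFreeRS : FreeNonUnitalNonAssocAlgebra k X →ₗ[k] FreeRS k X :=
  QuotientAlgebra.mk k (rightSymmetricRelations k X)

theorem toFreeRS_mul (x y : FreeNonUnitalNonAssocAlgebra k X) :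
    toFreeRS k (x * y) = toFreeRS k x * toFreeRS k y := rfl

theorem toFreeRS_surjective : Function.Surjective (toFreeRS k (X := X)) :=
  QuotientAlgebra.mk_surjective k _

theorem ofWord_mul (u v : FreeMagma X) :
    FreeRS.ofWord k (u * v) = FreeRS.ofWord k u * FreeRS.ofWord k v := rfl

theorem ofWord_of (x : X) : FreeRS.ofWord k (FreeMagma.of x) = FreeRS.gen k x := rfl

theorem toFreeRS_word (w : FreeMagma X) : toFreeRS k (word k w) = FreeRS.ofWord k w := by
  induction w with
  | ih1 x => rfl
  | ih2 u v ihu ihv => rw [word_mul, toFreeRS_mul, ihu, ihv, ofWord_mul]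

theorem assocRel_eq_zero (x y z : FreeRS k X) : assocRel x y z = 0 :=
  sub_eq_zero.2 (RightPreLieRing.assoc_symm x y z)

theorem mul_mem_of_mul_word_mem {N : Submodule k (FreeNonUnitalNonAssocAlgebra k X)}
    (h₁ : ∀ x ∈ N, ∀ w, x * word k w ∈ N) (h₂ : ∀ x ∈ N, ∀ w, word k w * x ∈ N) :
    ∀ x ∈ N, ∀ a, a * x ∈ N ∧ x * a ∈ N := fun x hx a =>
  ⟨map_wordSpan_le (LinearMap.mulRight k x) (fun w _ => h₂ x hx w) (mem_wordSpan_univ a),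
    map_wordSpan_le (LinearMap.mulLeft k x) (fun w _ => h₁ x hx w) (mem_wordSpan_univ a)⟩

variable [LinearOrder X]

theorem isGood_mul_iff {v w : FreeMagma X} :
    IsGood (v * w) ↔
      IsGood v ∧ IsGood w ∧ ∀ v₁ v₂ : FreeMagma X, v = v₁ * v₂ → WordLE v₂ w := by
  refine ⟨fun h => ?_, fun h => .mul h.1 h.2.1 h.2.2⟩
  generalize hu : v * w = u at h
  cases h with
  | of x => exact absurd hu.symm (of_ne_mul _ _ _)
  | mul h₁ h₂ h₃ =>
    obtain ⟨rfl, rfl⟩ := word_mul_inj.1 hu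
    exact ⟨h₁, h₂, h₃⟩

theorem isGood_of_mul {x : X} {w : FreeMagma X} (hw : IsGood w) : IsGood (FreeMagma.of x * w) :=
  .mul (.of x) hw fun _ _ h => absurd h (of_ne_mul _ _ _)

theorem isGood_of_mul_of_mul {x y : X} {w : FreeMagma X} (hw : IsGood w)
    (h : WordLE (FreeMagma.of y) w) : IsGood (FreeMagma.of x * FreeMagma.of y * w) :=
  .mul (isGood_of_mul (.of y)) hw fun _ _ h' => (word_mul_inj.1 h').2 ▸ h

/-- The right-symmetric identity alone, without additional relations, is resolvable. -/
theorem isResolvable_false :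
    IsResolvable (fun (_ : FreeNonUnitalNonAssocAlgebra k X) (_ _ : X) => False) where
  lead h := h.elim
  unique h := h.elim
  resolve h := h.elim

theorem IsGood.not_relator {w : FreeMagma X} (hw : IsGood w)
    (g : FreeNonUnitalNonAssocAlgebra k X) : ¬ Relator (fun _ _ _ => False) g w := by
  induction hw generalizing g with
  | of x => exact not_relator_of g x
  | mul _ _ h ihv ihw =>
    intro hg
    rcases relator_mul_iff.1 hg with ⟨_, _, _, _, h'⟩ | ⟨u, v, rfl, h', _⟩ | ⟨g', h', _⟩ |
      ⟨g', h', _⟩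
    · exact h'
    · exact not_wordLE_iff.2 h' (h u v rfl)
    · exact ihv g' h'
    · exact ihw g' h'

theorem mul_mem_relatorSpan_univ {B : FreeNonUnitalNonAssocAlgebra k X → X → X → Prop} :
    ∀ x ∈ relatorSpan B Set.univ, ∀ a, a * x ∈ relatorSpan B Set.univ ∧
      x * a ∈ relatorSpan B Set.univ :=
  mul_mem_of_mul_word_mem
    (fun _ hx _ => mul_word_mem_relatorSpan (fun _ _ => Set.mem_univ _) hx)
    (fun _ hx _ => word_mul_mem_relatorSpan (fun _ _ => Set.mem_univ _) hx)

/-- By linearity in each argument, `assocRel` of words suffices; for `v < w` the relation of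
`u`, `v`, `w` is minus a relator. -/
theorem idealSpan_rightSymmetricRelations_le
    (B : FreeNonUnitalNonAssocAlgebra k X → X → X → Prop) :
    idealSpan k (rightSymmetricRelations k X) ≤ relatorSpan B Set.univ := by
  refine sInf_le ⟨?_, mul_mem_relatorSpan_univ⟩
  rintro _ ⟨x, y, z, rfl⟩
  exact assocRel_mem_of_wordSpan (fun _ _ _ _ _ _ => Set.mem_univ _)
    (fun _ _ _ _ _ _ => Set.mem_univ _)
    (mem_wordSpan_univ x) (mem_wordSpan_univ y) (mem_wordSpan_univ z)

theorem mem_relatorSpan_of_toFreeRS_eq_zero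
    (B : FreeNonUnitalNonAssocAlgebra k X → X → X → Prop)
    {z : FreeNonUnitalNonAssocAlgebra k X} (h : toFreeRS k z = 0) :
    z ∈ relatorSpan B Set.univ := by
  have h' := (QuotientAlgebra.mk_eq_iff k (rightSymmetricRelations k X) (x := z) (y := 0)).1
    (h.trans (map_zero (toFreeRS k)).symm)
  rw [sub_zero] at h'
  exact idealSpan_rightSymmetricRelations_le B h'

theorem eq_zero_of_sum_ofWord_eq_zero [WellFoundedLT X] {a : FreeMagma X →₀ k}
    (ha : ∀ v ∈ a.support, IsGood v) (h : (a.sum fun v r => r • FreeRS.ofWord k v) = 0) :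
    a = 0 := by
  have hsum : (MonoidAlgebra.ofCoeff a : FreeNonUnitalNonAssocAlgebra k X) =
      a.sum fun v r => r • word k v := by
    have := (MonoidAlgebra.basis (FreeMagma X) k).linearCombination_repr (MonoidAlgebra.ofCoeff a)
    exact this.symm
  have hz : toFreeRS k (MonoidAlgebra.ofCoeff a) = 0 := by
    rw [hsum, map_finsuppSum, ← h]
    simp only [map_smul, toFreeRS_word]
  have := eq_zero_of_mem_relatorSpan isResolvable_false
    (mem_relatorSpan_of_toFreeRS_eq_zero (fun _ _ _ => False) hz) (fun g t hg => by
      by_contra hne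
      exact (ha t (Finsupp.mem_support_iff.2 hne)).not_relator g hg)
  exact congrArg MonoidAlgebra.coeff this

theorem HasLeadingWord.unique [WellFoundedLT X] {f : FreeRS k X} {w w' : FreeMagma X}
    (h : HasLeadingWord f w) (h' : HasLeadingWord f w') : w = w' := by
  obtain ⟨c, a, ha, hc, hc0, rfl⟩ := h
  obtain ⟨c', a', ha', hc', hc0', h⟩ := h'
  have hsub : a - a' = 0 := by
    classical
    refine eq_zero_of_sum_ofWord_eq_zero (k := k) (fun v hv => ?_) ?_
    · rcases Finset.mem_union.1 (Finsupp.support_sub hv) with hv | hv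
      · exact (ha v hv).1
      · exact (ha' v hv).1
    · rw [Finsupp.sum_sub_index (fun _ _ _ => sub_smul _ _ _), h, sub_self]
  obtain rfl := sub_eq_zero.1 hsub
  refine WordLE.antisymm (ha' w ?_).2 (ha w' ?_).2
  · rwa [Finsupp.mem_support_iff, hc]
  · rwa [Finsupp.mem_support_iff, hc']

theorem hasLeadingTerm_of_sub_mem {f : FreeRS k X} {w : FreeMagma X} (hw : IsGood w)
    (h : f - FreeRS.ofWord k w ∈
      Submodule.span k (FreeRS.ofWord k '' {v | IsGood v ∧ WordLT v w})) :
    HasLeadingTerm f w 1 := by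
  classical
  obtain ⟨a, ha, hf⟩ := (Finsupp.mem_span_image_iff_linearCombination k).1 h
  have haw : a w = 0 := by
    by_contra hne
    exact wordLT_irrefl w (ha (Finsupp.mem_support_iff.2 hne)).2
  refine ⟨a + Finsupp.single w 1, fun v hv => ?_, ?_, one_ne_zero, ?_⟩
  · rcases Finset.mem_union.1 (Finsupp.support_add hv) with hv | hv
    · exact ⟨(ha hv).1, Or.inr (ha hv).2⟩
    · obtain rfl := Finset.mem_singleton.1 (Finsupp.support_single_subset hv)
      exact ⟨hw, Or.inl rfl⟩
  · simp [haw]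
  · change f = Finsupp.linearCombination k (FreeRS.ofWord k) (a + Finsupp.single w 1)
    rw [map_add, hf, Finsupp.linearCombination_single, one_smul, sub_add_cancel]

end GoodWords

/-! ### The relations of the enveloping algebra -/

section BracketRelations

/-- The element `e_i e_j - e_j e_i - {e_i e_j}` for a family `e`, indexed by a basis of a Lie
algebra, in any non-associative algebra. -/
def bracketRel {k L I A : Type*} [Field k] [LieRing L] [LieAlgebra k L]
    [NonUnitalNonAssocRing A] [Module k A] (b : Module.Basis I k L) (e : I → A) (i j : I) : A :=
  e i * e j - e j * e i - b.constr k e ⁅b i, b j⁆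

variable {k : Type*} [Field k] {L : Type*} [LieRing L] [LieAlgebra k L] {I : Type*}
  (b : Module.Basis I k L) {A : Type*} [NonUnitalNonAssocRing A] [Module k A] (e : I → A)

theorem bracketRel_self (i : I) : bracketRel b e i i = 0 := by
  simp [bracketRel]

theorem neg_bracketRel (i j : I) : -bracketRel b e i j = bracketRel b e j i := by
  rw [bracketRel, bracketRel, ← lie_skew (b j) (b i), map_neg]
  abel

/-- An identity in any non-associative algebra; only the Jacobi identity of the Lie algebra is
needed, and only to cancel the terms in which a double bracket occurs. -/
theorem bracketRel_mul_eq (i j l : I) :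
    bracketRel b e i j * e l =
      bracketRel b e i l * e j - bracketRel b e j l * e i + e i * bracketRel b e j l
        - e j * bracketRel b e i l + e l * bracketRel b e i j
        + ((e i * b.constr k e ⁅b j, b l⁆ - b.constr k e ⁅b j, b l⁆ * e i -
              b.constr k e ⁅b i, ⁅b j, b l⁆⁆)
          - (e j * b.constr k e ⁅b i, b l⁆ - b.constr k e ⁅b i, b l⁆ * e j -
              b.constr k e ⁅b j, ⁅b i, b l⁆⁆)
          + (e l * b.constr k e ⁅b i, b j⁆ - b.constr k e ⁅b i, b j⁆ * e l -
              b.constr k e ⁅b l, ⁅b i, b j⁆⁆))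
        + (assocRel (e i) (e j) (e l) - assocRel (e j) (e i) (e l)
          + assocRel (e l) (e i) (e j)) := by
  have hJ : b.constr k e ⁅b l, ⁅b i, b j⁆⁆ =
      b.constr k e ⁅b j, ⁅b i, b l⁆⁆ - b.constr k e ⁅b i, ⁅b j, b l⁆⁆ := by
    rw [← map_sub, ← lie_skew, lie_lie, neg_sub]
  rw [hJ]
  simp only [bracketRel, assocRel_eq, mul_sub, sub_mul]
  abel

theorem span_bracketRel_le [LinearOrder I] {N : Submodule k A}
    (h : ∀ i j, j < i → bracketRel b e i j ∈ N) :
    Submodule.span k (Set.range fun p : I × I => bracketRel b e p.1 p.2) ≤ N := by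
  refine Submodule.span_le.2 ?_
  rintro _ ⟨⟨i, j⟩, rfl⟩
  rcases lt_trichotomy i j with hij | rfl | hij
  · change bracketRel b e i j ∈ N
    rw [← neg_bracketRel]
    exact neg_mem (h j i hij)
  · change bracketRel b e i i ∈ N
    rw [bracketRel_self]
    exact zero_mem N
  · exact h i j hij

theorem constr_mem {N : Submodule k A} (h : ∀ i, e i ∈ N) (x : L) : b.constr k e x ∈ N := by
  have hx : b.constr k e x ∈ LinearMap.range (b.constr k e) := ⟨x, rfl⟩
  rw [b.constr_range] at hx
  exact Submodule.span_le.2 (Set.range_subset_iff.2 h) hx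

variable [IsScalarTower k A A] [SMulCommClass k A A]

theorem commutator_constr_mem_span (i : I) (x : L) :
    e i * b.constr k e x - b.constr k e x * e i - b.constr k e ⁅b i, x⁆ ∈
      Submodule.span k (Set.range fun p : I × I => bracketRel b e p.1 p.2) := by
  have key : Submodule.span k (Set.range b) ≤
      (Submodule.span k (Set.range fun p : I × I => bracketRel b e p.1 p.2)).comap
        (LinearMap.mulLeft k (e i) ∘ₗ b.constr k e - LinearMap.mulRight k (e i) ∘ₗ b.constr k e -
          b.constr k e ∘ₗ (LieAlgebra.ad k L (b i) : L →ₗ[k] L)) := by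
    refine Submodule.span_le.2 ?_
    rintro _ ⟨j, rfl⟩
    refine Submodule.subset_span ⟨(i, j), ?_⟩
    simp [bracketRel]
  exact key (b.mem_span x)

/-- The products `e_i {e_j e_l}` and `{e_j e_l} e_i` that are left over when `f_{ij} e_l` is
expanded combine to relations of length two. -/
theorem bracketRel_mul (i j l : I) :
    ∃ c ∈ Submodule.span k (Set.range fun p : I × I => bracketRel b e p.1 p.2),
    bracketRel b e i j * e l =
      bracketRel b e i l * e j - bracketRel b e j l * e i + e i * bracketRel b e j l
        - e j * bracketRel b e i l + e l * bracketRel b e i j + c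
        + (assocRel (e i) (e j) (e l) - assocRel (e j) (e i) (e l)
          + assocRel (e l) (e i) (e j)) :=
  ⟨_, add_mem (sub_mem (commutator_constr_mem_span b e i _) (commutator_constr_mem_span b e j _))
    (commutator_constr_mem_span b e l _), bracketRel_mul_eq b e i j l⟩

end BracketRelations

/-! ### The embedding into the enveloping algebra -/

section EnvelopingAlgebra

variable {k : Type*} [Field k] {L : Type*} [LieRing L] [LieAlgebra k L]
  {I : Type*} (b : Module.Basis I k L)

/-- The letters as elements of the free non-associative algebra. -/
def letter (k : Type*) [Field k] {I : Type*} (i : I) : FreeNonUnitalNonAssocAlgebra k I :=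
  word k (FreeMagma.of i)

theorem letter_eq (i : I) : letter k i = word k (FreeMagma.of i) := rfl

theorem toFreeRS_letter (i : I) : toFreeRS k (letter k i) = FreeRS.gen k i := rfl

theorem toFreeRS_constr (x : L) :
    toFreeRS k (b.constr k (letter k) x) = linearPart b x := by
  have : toFreeRS k ∘ₗ b.constr k (letter k) = linearPart b :=
    b.ext fun i => by simp [linearPart, toFreeRS_letter]
  exact LinearMap.congr_fun this x

theorem toFreeRS_bracketRel (i j : I) :
    toFreeRS k (bracketRel b (letter k) i j) = envelopingRelation b i j := by
  rw [bracketRel, map_sub, map_sub, toFreeRS_constr]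
  rfl

theorem envelopingRelation_eq (i j : I) :
    envelopingRelation b i j = bracketRel b (FreeRS.gen k) i j := rfl

theorem constr_letter_injective : Function.Injective (b.constr k (letter k)) := by
  refine (injective_iff_map_eq_zero _).2 fun x hx => ?_
  have hli : LinearIndependent k (letter k : I → FreeNonUnitalNonAssocAlgebra k I) :=
    (MonoidAlgebra.basis (FreeMagma I) k).linearIndependent.comp _ fun _ _ h => of_inj.1 h
  rw [b.constr_apply] at hx
  exact b.repr.map_eq_zero_iff.1 (linearIndependent_iff.1 hli _ hx)

theorem constr_letter_mem (x : L) :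
    b.constr k (letter k) x ∈ wordSpan k {w | w.length = 1} :=
  constr_mem b (letter k) (N := wordSpan k {w | w.length = 1})
    (fun i => word_mem_wordSpan (w := FreeMagma.of i) (length_of i)) x

variable [LinearOrder I]

/-- The relations `f_{ij}`, for `i > j`, in the free non-associative algebra, with their leading
words `e_i e_j`. -/
def EnvelopingRelator (f : FreeNonUnitalNonAssocAlgebra k I) (i j : I) : Prop :=
  j < i ∧ f = bracketRel b (letter k) i j

theorem relator_bracketRel {i j : I} (h : j < i) :
    Relator (EnvelopingRelator b) (bracketRel b (letter k) i j)
      (FreeMagma.of i * FreeMagma.of j) :=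
  .base ⟨h, rfl⟩

theorem isResolvable_envelopingRelator : IsResolvable (EnvelopingRelator b) where
  lead := by
    rintro _ i j ⟨hij, rfl⟩
    have key : bracketRel b (letter k) i j - word k (FreeMagma.of i * FreeMagma.of j) =
        -word k (FreeMagma.of j * FreeMagma.of i) - b.constr k (letter k) ⁅b i, b j⁆ := by
      simp only [bracketRel, word_mul, letter_eq]
      abel
    rw [key]
    refine sub_mem (neg_mem (word_mem_wordSpan ?_)) (wordSpan_mono ?_ (constr_letter_mem b _))
    · exact .left rfl (.letter hij)
    · intro t (ht : t.length = 1)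
      exact .length (ht.trans_lt (Nat.lt_succ_self 1))
  unique := by
    rintro _ _ i j ⟨-, rfl⟩ ⟨-, rfl⟩
    rfl
  resolve := by
    rintro _ i j l ⟨hji, rfl⟩ hlj
    obtain ⟨c, hc, h⟩ := bracketRel_mul b (letter k) i j l
    have hli := hlj.trans hji
    -- The words of length three below `e_i e_j e_l` that occur as leading words.
    have hil : WordLT (FreeMagma.of i * FreeMagma.of l * FreeMagma.of j)
        (FreeMagma.of i * FreeMagma.of j * FreeMagma.of l) :=
      .left rfl (.right rfl (.letter hlj))
    have hleft : ∀ {p q r : I}, p < i → FreeMagma.of p * FreeMagma.of q * FreeMagma.of r ∈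
        lower (FreeMagma.of i * FreeMagma.of j * FreeMagma.of l) :=
      fun hp => .left rfl (.left rfl (.letter hp))
    have hright : ∀ {p q r : I}, FreeMagma.of p * (FreeMagma.of q * FreeMagma.of r) ∈
        lower (FreeMagma.of i * FreeMagma.of j * FreeMagma.of l) :=
      .left rfl (.length (Nat.lt_succ_self 1))
    have key : assocRel (letter k i) (letter k j) (letter k l) -
        bracketRel b (letter k) i j * letter k l =
          bracketRel b (letter k) j l * letter k i - bracketRel b (letter k) i l * letter k j
            - letter k i * bracketRel b (letter k) j l + letter k j * bracketRel b (letter k) i l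
            - letter k l * bracketRel b (letter k) i j - c
            + assocRel (letter k j) (letter k i) (letter k l)
            - assocRel (letter k l) (letter k i) (letter k j) := by
      rw [h]
      abel
    simp only [← letter_eq]
    rw [key]
    refine sub_mem (add_mem (sub_mem (sub_mem (add_mem (sub_mem (sub_mem ?_ ?_) ?_) ?_) ?_) ?_)
      ?_) ?_
    · exact ((relator_bracketRel b hlj).mul_right _).mem_relatorSpan (hleft hji)
    · exact ((relator_bracketRel b hli).mul_right _).mem_relatorSpan hil
    · exact ((relator_bracketRel b hlj).mul_left _).mem_relatorSpan hright
    · exact ((relator_bracketRel b hli).mul_left _).mem_relatorSpan hright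
    · exact ((relator_bracketRel b hji).mul_left _).mem_relatorSpan hright
    · exact span_bracketRel_le b _ (fun p q hqp => (relator_bracketRel b hqp).mem_relatorSpan
        (.length (Nat.lt_succ_self 2))) hc
    · exact assocRel_mem_relatorSpan (hleft hji) (hleft hji)
    · exact assocRel_mem_relatorSpan (hleft hli) (hleft hli)

/-- The relations `f_{ij}` with `i ≤ j` are accounted for by `f_{ii} = 0` and `f_{ij} = -f_{ji}`. -/
theorem idealSpan_envelopingRelation_le :
    idealSpan k {r : FreeRS k I | ∃ i j, r = envelopingRelation b i j} ≤
      (relatorSpan (EnvelopingRelator b) Set.univ).map (toFreeRS k) := by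
  refine sInf_le ⟨?_, ?_⟩
  · rintro _ ⟨i, j, rfl⟩
    refine ⟨_, ?_, toFreeRS_bracketRel b i j⟩
    exact span_bracketRel_le b (letter k)
      (fun p q hqp => (relator_bracketRel b hqp).mem_relatorSpan (Set.mem_univ _))
      (Submodule.subset_span ⟨(i, j), rfl⟩)
  · rintro _ ⟨x, hx, rfl⟩ a
    obtain ⟨a, rfl⟩ := toFreeRS_surjective a
    exact ⟨⟨_, (mul_mem_relatorSpan_univ x hx a).1, rfl⟩,
      ⟨_, (mul_mem_relatorSpan_univ x hx a).2, rfl⟩⟩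

/-- A linear combination of letters that vanishes in the enveloping algebra is a combination of
relators, hence zero, since no relator has a letter as its leading word. -/
theorem toEnvelopingRS_injective [WellFoundedLT I] : Function.Injective (toEnvelopingRS b) := by
  refine (injective_iff_map_eq_zero _).2 fun x hx => ?_
  have hx' := (QuotientAlgebra.mk_eq_iff k _ (x := linearPart b x) (y := 0)).1
    (hx.trans (map_zero (QuotientAlgebra.mk k _)).symm)
  rw [sub_zero] at hx'
  obtain ⟨y, hy, hyx⟩ := idealSpan_envelopingRelation_le b hx'
  rw [← toFreeRS_constr, ← sub_eq_zero, ← map_sub] at hyx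
  have hmem := sub_mem hy (mem_relatorSpan_of_toFreeRS_eq_zero (EnvelopingRelator b) hyx)
  rw [sub_sub_cancel] at hmem
  refine constr_letter_injective b ?_
  rw [map_zero]
  refine eq_zero_of_mem_relatorSpan (isResolvable_envelopingRelator b) hmem fun g t hg => ?_
  refine coeff_eq_zero_of_mem_wordSpan (fun ht => ?_) (constr_letter_mem b x)
  obtain ⟨i, rfl⟩ := exists_of_length_eq_one ht
  exact not_relator_of g i hg

/-! ### Leading words and compositions of the relations -/

theorem isGood_of_mul_of (i j : I) : IsGood (FreeMagma.of i * FreeMagma.of j) :=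
  isGood_of_mul (.of j)

theorem hasLeadingTerm_envelopingRelation {i j : I} (h : j < i) :
    HasLeadingTerm (envelopingRelation b i j) (FreeMagma.of i * FreeMagma.of j) 1 := by
  refine hasLeadingTerm_of_sub_mem (isGood_of_mul_of i j) ?_
  have key : envelopingRelation b i j - FreeRS.ofWord k (FreeMagma.of i * FreeMagma.of j) =
      -FreeRS.ofWord k (FreeMagma.of j * FreeMagma.of i) - linearPart b ⁅b i, b j⁆ := by
    simp only [envelopingRelation, ofWord_mul, ofWord_of]
    abel
  rw [key]
  refine sub_mem (neg_mem (Submodule.subset_span ⟨_, ⟨isGood_of_mul_of j i, ?_⟩, rfl⟩)) ?_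
  · exact .left rfl (.letter h)
  · refine constr_mem b (FreeRS.gen k) (fun m => Submodule.subset_span ?_) _
    exact ⟨FreeMagma.of m, ⟨.of m, .length (Nat.lt_succ_self 1)⟩, rfl⟩

/-- The word `(e_i e_j) e_l` is not good for `j > l`; it is replaced by `(e_i e_l) e_j`, which is
larger than all other words that occur. -/
theorem hasLeadingTerm_envelopingRelation_mul {i j l : I} (hlj : l < j) (hji : j < i) :
    HasLeadingTerm (envelopingRelation b i j * FreeRS.gen k l)
      (FreeMagma.of i * FreeMagma.of l * FreeMagma.of j) 1 := by
  have hgood : ∀ {p q r : I}, q ≤ r →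
      IsGood (FreeMagma.of p * FreeMagma.of q * FreeMagma.of r) := fun h =>
    isGood_of_mul_of_mul (.of _) (h.lt_or_eq.elim (fun h => Or.inr (.letter h)) fun h =>
      Or.inl (of_inj.2 h))
  refine hasLeadingTerm_of_sub_mem (hgood hlj.le) ?_
  set e := FreeRS.gen k (X := I)
  have key : envelopingRelation b i j * e l -
      FreeRS.ofWord k (FreeMagma.of i * FreeMagma.of l * FreeMagma.of j) =
      e i * (e j * e l) - e i * (e l * e j) - e j * e l * e i - e j * (e i * e l)
        + e j * (e l * e i) - linearPart b ⁅b i, b j⁆ * e l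
        + (assocRel (e i) (e j) (e l) - assocRel (e j) (e i) (e l)) := by
    simp only [envelopingRelation, ofWord_mul, ofWord_of, assocRel_eq, sub_mul]
    abel
  rw [key, assocRel_eq_zero, assocRel_eq_zero, sub_zero, add_zero]
  have hright : ∀ p q r : I, e p * (e q * e r) ∈ Submodule.span k (FreeRS.ofWord k ''
      {v | IsGood v ∧ WordLT v (FreeMagma.of i * FreeMagma.of l * FreeMagma.of j)}) := fun p q r =>
    Submodule.subset_span ⟨FreeMagma.of p * (FreeMagma.of q * FreeMagma.of r),
      ⟨isGood_of_mul (isGood_of_mul_of q r), .left rfl (.length (Nat.lt_succ_self 1))⟩, rfl⟩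
  refine sub_mem (add_mem (sub_mem (sub_mem (sub_mem (hright i j l) (hright i l j)) ?_)
    (hright j i l)) (hright j l i)) ?_
  · exact Submodule.subset_span ⟨FreeMagma.of j * FreeMagma.of l * FreeMagma.of i,
      ⟨hgood (hlj.trans hji).le, .left rfl (.left rfl (.letter hji))⟩, rfl⟩
  · refine constr_mem b _ (N := (Submodule.span k _).comap (LinearMap.mulRight k (e l)))
      (fun m => ?_) _
    exact Submodule.subset_span ⟨FreeMagma.of m * FreeMagma.of l,
      ⟨isGood_of_mul_of m l, .length (Nat.lt_succ_self 2)⟩, rfl⟩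

theorem isNormalSWord_of_isSWord {i j : I} (h : j < i) {p : FreeRS k I} {u : FreeMagma I}
    (hp : IsSWord (envelopingRelation b i j) (FreeMagma.of i * FreeMagma.of j) p u)
    (hu : IsGood u) : IsNormalSWord (envelopingBasis b) p u :=
  ⟨_, ⟨i, j, h, rfl⟩, _, ⟨1, hasLeadingTerm_envelopingRelation b h⟩, hp, hu⟩

theorem isRightMulTrivialMod_envelopingRelation_mul {i j l : I} (hlj : l < j) (hji : j < i) :
    IsRightMulTrivialMod (envelopingBasis b) (envelopingRelation b i j * FreeRS.gen k l) := by
  refine ⟨_, ⟨1, hasLeadingTerm_envelopingRelation_mul b hlj hji⟩, ?_⟩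
  have hli := hlj.trans hji
  obtain ⟨c, hc, h⟩ := bracketRel_mul b (FreeRS.gen k) i j l
  simp only [← envelopingRelation_eq, assocRel_eq_zero, sub_zero, add_zero] at h hc
  rw [h]
  have hleft : ∀ {p q : I} (hqp : q < p) (r : I), q < r → WordLE
      (FreeMagma.of p * FreeMagma.of q * FreeMagma.of r)
      (FreeMagma.of i * FreeMagma.of l * FreeMagma.of j) →
      envelopingRelation b p q * FreeRS.gen k r ∈ Submodule.span k {p | ∃ u,
        IsNormalSWord (envelopingBasis b) p u ∧
          WordLE u (FreeMagma.of i * FreeMagma.of l * FreeMagma.of j)} :=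
    fun hqp r hqr hle => Submodule.subset_span ⟨_, isNormalSWord_of_isSWord b hqp
      (.mul_right .self (.of r)) (isGood_of_mul_of_mul (.of r) (Or.inr (.letter hqr))), hle⟩
  have hright : ∀ {p q : I} (hqp : q < p) (r : I),
      FreeRS.gen k r * envelopingRelation b p q ∈ Submodule.span k {p | ∃ u,
        IsNormalSWord (envelopingBasis b) p u ∧
          WordLE u (FreeMagma.of i * FreeMagma.of l * FreeMagma.of j)} :=
    fun {p q} hqp r => Submodule.subset_span ⟨_, isNormalSWord_of_isSWord b hqp
      (.mul_left .self (.of r)) (isGood_of_mul (isGood_of_mul_of p q)),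
        Or.inr (.left rfl (.length (Nat.lt_succ_self 1)))⟩
  refine add_mem (add_mem (sub_mem (add_mem (sub_mem ?_ ?_) ?_) ?_) ?_) ?_
  · exact hleft hli j hlj (Or.inl rfl)
  · exact hleft hlj i hli (Or.inr (.left rfl (.left rfl (.letter hji))))
  · exact hright hlj i
  · exact hright hli j
  · exact hright hji l
  · refine span_bracketRel_le b (FreeRS.gen k) (fun p q hqp => Submodule.subset_span ?_) hc
    exact ⟨_, isNormalSWord_of_isSWord b hqp .self (isGood_of_mul_of p q),
      Or.inr (.length (Nat.lt_succ_self 2))⟩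

theorem IsSWord.length_le {s p : FreeRS k I} {t u : FreeMagma I}
    (h : IsSWord s t p u) : t.length ≤ u.length := by
  induction h with
  | self => exact le_rfl
  | mul_right _ _ ih => exact ih.trans (Nat.le_add_right _ _)
  | mul_left _ _ ih => exact ih.trans (Nat.le_add_left _ _)

theorem IsSWord.eq_of_length_le {s p : FreeRS k I} {t u : FreeMagma I}
    (h : IsSWord s t p u) (hle : u.length ≤ t.length) : p = s ∧ u = t := by
  cases h with
  | self => exact ⟨rfl, rfl⟩
  | @mul_right p u v h _ =>
    have := h.length_le
    have := v.length_pos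
    rw [length_mul] at hle
    omega
  | @mul_left p u v h _ =>
    have := h.length_le
    have := v.length_pos
    rw [length_mul] at hle
    omega

variable [WellFoundedLT I]

theorem HasLeadingWord.eq_of_envelopingRelation {i j : I} (h : j < i) {t : FreeMagma I}
    (ht : HasLeadingWord (envelopingRelation b i j) t) :
    t = FreeMagma.of i * FreeMagma.of j :=
  ht.unique ⟨1, hasLeadingTerm_envelopingRelation b h⟩

theorem isRightMulComposition_envelopingBasis_iff {f : FreeRS k I} (hf : f ∈ envelopingBasis b)
    (w : FreeMagma I) :
    IsRightMulComposition f w ↔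
      ∃ i j l : I, l < j ∧ j < i ∧ f = envelopingRelation b i j ∧ w = FreeMagma.of l := by
  constructor
  · rintro ⟨hw, t, ht, hbad⟩
    obtain ⟨i, j, hji, rfl⟩ := hf
    obtain rfl := ht.eq_of_envelopingRelation b hji
    have hlt : WordLT w (FreeMagma.of j) :=
      not_wordLE_iff.1 fun hle => hbad (isGood_of_mul_of_mul hw hle)
    obtain ⟨l, rfl⟩ := exists_of_length_eq_one (le_antisymm hlt.length_le w.length_pos)
    exact ⟨i, j, l, wordLT_of_of_iff.1 hlt, hji, rfl, rfl⟩
  · rintro ⟨i, j, l, hlj, hji, rfl, rfl⟩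
    refine ⟨.of l, _, ⟨1, hasLeadingTerm_envelopingRelation b hji⟩, fun hgood => ?_⟩
    exact not_wordLE_iff.2 (.letter hlj) ((isGood_mul_iff.1 hgood).2.2 _ _ rfl)

/-- All leading words have length two, so that one contains another only if they are equal. -/
theorem eq_of_isInclusionComposition {f g : FreeRS k I} (hf : f ∈ envelopingBasis b)
    (hg : g ∈ envelopingBasis b) {w : FreeMagma I} {h : FreeRS k I}
    (hc : IsInclusionComposition f g w h) : f = g ∧ h = 0 := by
  obtain ⟨i, j, hji, rfl⟩ := hf
  obtain ⟨i', j', hji', rfl⟩ := hg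
  obtain ⟨hw, p, ⟨_, rfl, t, ht, hp, -⟩, rfl⟩ := hc
  obtain rfl := hw.eq_of_envelopingRelation b hji
  obtain rfl := ht.eq_of_envelopingRelation b hji'
  obtain ⟨rfl, hu⟩ := hp.eq_of_length_le le_rfl
  obtain ⟨hi, hj⟩ := word_mul_inj.1 hu
  obtain rfl := of_inj.1 hi
  obtain rfl := of_inj.1 hj
  exact ⟨rfl, sub_self _⟩

theorem isGroebnerShirshovBasis_envelopingBasis :
    IsGroebnerShirshovBasis (envelopingBasis b) where
  monic := by
    rintro _ ⟨i, j, hji, rfl⟩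
    exact ⟨_, hasLeadingTerm_envelopingRelation b hji⟩
  inclusion_trivial f hf g hg w h hc := by
    rw [(eq_of_isInclusionComposition b hf hg hc).2]
    exact zero_mem (Submodule.span k _)
  rightMul_trivial f hf w hc := by
    obtain ⟨i, j, l, hlj, hji, rfl, rfl⟩ := (isRightMulComposition_envelopingBasis_iff b hf w).1 hc
    exact isRightMulTrivialMod_envelopingRelation_mul b hlj hji

end EnvelopingAlgebra

end

end RightSymmetric

theorem mainTheorem2 {k : Type*} [Field k] {L : Type*} [LieRing L] [LieAlgebra k L]
    {I : Type*} [LinearOrder I] [WellFoundedLT I] (b : Module.Basis I k L) :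
    RightSymmetric.IsGroebnerShirshovBasis (RightSymmetric.envelopingBasis b) ∧
    (∀ i j : I, j < i → RightSymmetric.HasLeadingTerm (RightSymmetric.envelopingRelation b i j)
      (FreeMagma.of i * FreeMagma.of j) 1) ∧
    (∀ f ∈ RightSymmetric.envelopingBasis b, ∀ w : FreeMagma I,
      RightSymmetric.IsRightMulComposition f w ↔
        ∃ i j l : I, l < j ∧ j < i ∧ f = RightSymmetric.envelopingRelation b i j ∧
          w = FreeMagma.of l) ∧
    (∀ f ∈ RightSymmetric.envelopingBasis b, ∀ g ∈ RightSymmetric.envelopingBasis b,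
      ∀ (w : FreeMagma I) (h : RightSymmetric.FreeRS k I),
        RightSymmetric.IsInclusionComposition f g w h → f = g ∧ h = 0) ∧
    Function.Injective (RightSymmetric.toEnvelopingRS b) :=
  ⟨RightSymmetric.isGroebnerShirshovBasis_envelopingBasis b,
    fun _ _ h => RightSymmetric.hasLeadingTerm_envelopingRelation b h,
    fun _ hf w => RightSymmetric.isRightMulComposition_envelopingBasis_iff b hf w,
    fun _ hf _ hg _ _ hc => RightSymmetric.eq_of_isInclusionComposition b hf hg hc,
    RightSymmetric.toEnvelopingRS_injective b⟩
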